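/- Let $\sigma_1,\sigma_2,\sigma_3$ be the Pauli matrices, $\sigma\cdot\nabla=\sum_k\sigma_k\partial_k$, and let $V:\mathbb R^3\to\mathbb R$ be a function in $L^2_{\rm loc}(\mathbb R^3)$, so that $$(H_0+V)\begin{pmatrix}\varphi\\ \chi\end{pmatrix}=\begin{pmatrix}(V+1)\varphi-i\sigma\cdot\nabla\chi\\ -i\sigma\cdot\nabla\varphi+(V-1)\chi\end{pmatrix}$$ is defined from $C_c^\infty(\mathbb R^3,\mathbb C^4)$ to $L^2(\mathbb R^3,\mathbb C^4)$. Suppose that (A) holds: for some constant $c=c(V)\in(-1,1)$, $\Gamma:=\sup_{\mathbb R^3} V<1+c$ and, for all $\varphi\in C_c^\infty(\mathbb R^3,\mathbb C^2)$, $$\int_{\mathbb R^3}\left(\frac{|\sigma\cdot\nabla\varphi|^2}{1+c-V}+(1-c+V)|\varphi|^2\right)dx\ \ge\ 0 .$$ For $\gamma\in(\Gamma,1+c)$ let $\mathcal H_{+1}\subset L^2(\mathbb R^3,\mathbb C^2)$ be the form domain of the closure of the quadratic form $$b_\gamma(\varphi,\varphi)=\int_{\mathbb R^3}\left(\frac{|\sigma\cdot\nabla\varphi|^2}{\gamma-V}+(2-\gamma+V)|\varphi|^2\right)dx,\qquad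 \varphi\in C_c^\infty(\mathbb R^3,\mathbb C^2),$$ that is, the set of $L^2$-limits of sequences of test spinors that are Cauchy with respect to $b_\gamma$. Then $\mathcal H_{+1}$ does not depend on $\gamma$. Let $\mathcal D$ be the set of all pairs $(\varphi,\chi)\in\mathcal H_{+1}\times L^2(\mathbb R^3,\mathbb C^2)$ for which both expressions $(V+1)\varphi-i\sigma\cdot\nabla\chi$ and $-i\sigma\cdot\nabla\varphi+(V-1)\chi$, understood in the weak sense (tested against $C_c^\infty(\mathbb R^3,\mathbb C^2)$), lie in $L^2(\mathbb R^3,\mathbb C^2)$. Then the operator $H_0+V$ with domain $\mathcal D$ is self-adjoint in $L^2(\mathbb R^3,\mathbb C^4)$, and it is the unique self-adjoint extension of $H_0+V$ on $C_c^\infty(\mathbb R^3,\mathbb C^4)$ whose domain is contained in $\mathcal H_{+1}\times L^2(\mathbb R^3,\mathbb C^2)$. This covers the critical Coulomb case: $V(x)=-1/|x|$ is in $L^2_{\rm loc}(\mathbb R^3)$ and satisfies (A) with $c(V)=0$. -/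

import Mathlib

open MeasureTheory Filter Topology
open scoped ContDiff

noncomputable section

namespace HardyDirac

/-- The physical space `ℝ³`. -/
abbrev Space : Type := EuclideanSpace ℝ (Fin 3)

/-- Two-component spinors `ℂ²`, with the Hermitian norm. -/
abbrev Spinor : Type := EuclideanSpace ℂ (Fin 2)

/-- The Hilbert space `L²(ℝ³, ℂ²)`. -/
abbrev L2 : Type := Lp Spinor 2 (volume : Measure Space)

/-- The Hilbert space `L²(ℝ³, ℂ⁴) = L²(ℝ³, ℂ²) ⊕ L²(ℝ³, ℂ²)`, whose elements are pairs of
an upper component `u.fst` and a lower component `u.snd`. -/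
abbrev L2Pair : Type := WithLp 2 (L2 × L2)

/-- The Pauli matrices. -/
def pauli : Fin 3 → Matrix (Fin 2) (Fin 2) ℂ :=
  ![!![0, 1; 1, 0], !![0, -Complex.I; Complex.I, 0], !![1, 0; 0, -1]]

/-- `σ·∇ f = ∑ₖ σₖ ∂ₖ f`, for a differentiable two-spinor field `f`. -/
def sigmaGrad (f : Space → Spinor) (x : Space) : Spinor :=
  ∑ k : Fin 3, Matrix.toEuclideanLin (pauli k) (fderiv ℝ f x (EuclideanSpace.single k 1))

/-- `-i σ·∇ f`. -/
def sigmaP (f : Space → Spinor) (x : Space) : Spinor := (-Complex.I) • sigmaGrad f x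

/-- `f ∈ C_c^∞(ℝ³, ℂ²)`. -/
def IsTest (f : Space → Spinor) : Prop := ContDiff ℝ ∞ f ∧ HasCompactSupport f

/-- `V ∈ L²_loc(ℝ³)`: this says that `H₀ + V` maps `C_c^∞(ℝ³, ℂ⁴)` into `L²(ℝ³, ℂ⁴)`. -/
def LocallyL2 (V : Space → ℝ) : Prop :=
  ∀ K : Set Space, IsCompact K → MemLp V 2 (volume.restrict K)

/-- Assumption (A) with the constant `c = c(V)`: `c ∈ (-1, 1)`, `sup V < 1 + c`, and the
Hardy-Dirac inequality holds on `C_c^∞(ℝ³, ℂ²)`. -/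
structure AssumptionA (V : Space → ℝ) (c : ℝ) : Prop where
  neg_one_lt : -1 < c
  lt_one : c < 1
  bddAbove : BddAbove (Set.range V)
  iSup_lt : (⨆ x, V x) < 1 + c
  hardyDirac : ∀ f : Space → Spinor, IsTest f →
    0 ≤ ∫ x, (‖sigmaGrad f x‖ ^ 2 / (1 + c - V x) + (1 - c + V x) * ‖f x‖ ^ 2)

/-- The quadratic form `b_γ(f, f)` on `C_c^∞(ℝ³, ℂ²)`. -/
def form (V : Space → ℝ) (γ : ℝ) (f : Space → Spinor) : ℝ :=
  ∫ x, (‖sigmaGrad f x‖ ^ 2 / (γ - V x) + (2 - γ + V x) * ‖f x‖ ^ 2)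

/-- The form domain `ℋ_{+1}` of the closure of `b_γ`: the `φ ∈ L²` that are the `L²`-limit of
a sequence of test spinors which is Cauchy with respect to `b_γ`. -/
def formDomain (V : Space → ℝ) (γ : ℝ) : Set L2 :=
  {φ | ∃ f : ℕ → Space → Spinor, (∀ n, IsTest (f n)) ∧
    Tendsto (fun n => eLpNorm (fun x => f n x - φ x) 2 volume) atTop (𝓝 0) ∧
    Tendsto (fun p : ℕ × ℕ => form V γ (fun x => f p.1 x - f p.2 x)) atTop (𝓝 0)}

/-- `v = (H₀ + V) u` in the weak sense: writing `u = (φ, χ)`, the two components of `v` are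
`(V + 1) φ - i σ·∇ χ` and `-i σ·∇ φ + (V - 1) χ`, tested against all `η ∈ C_c^∞(ℝ³, ℂ²)`. -/
def WeakDirac (V : Space → ℝ) (u v : L2Pair) : Prop :=
  ∀ η : Space → Spinor, IsTest η →
    (∫ x, inner ℂ (η x) (((V x + 1 : ℝ) : ℂ) • u.fst x)) + (∫ x, inner ℂ (sigmaP η x) (u.snd x))
        = ∫ x, inner ℂ (η x) (v.fst x) ∧
    (∫ x, inner ℂ (η x) (((V x - 1 : ℝ) : ℂ) • u.snd x)) + (∫ x, inner ℂ (sigmaP η x) (u.fst x))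
        = ∫ x, inner ℂ (η x) (v.snd x)

/-- `T` is the operator `H₀ + V` with domain
`𝒟 = {(φ, χ) ∈ ℋ_{+1} × L² : (V + 1) φ - i σ·∇ χ ∈ L² and -i σ·∇ φ + (V - 1) χ ∈ L²}`,
the expressions being understood in the weak sense. (The graph determines `T`.) -/
def IsDiracOperator (V : Space → ℝ) (γ : ℝ) (T : L2Pair →ₗ.[ℂ] L2Pair) : Prop :=
  ∀ u v : L2Pair, (u, v) ∈ T.graph ↔ u.fst ∈ formDomain V γ ∧ WeakDirac V u v

/-- `T` extends `H₀ + V` on `C_c^∞(ℝ³, ℂ⁴)`: if `u = (f, g)` almost everywhere with test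
spinors `f`, `g`, then `u` is in the domain of `T` and
`T u = ((V + 1) f - i σ·∇ g, -i σ·∇ f + (V - 1) g)`. -/
def ExtendsDirac (V : Space → ℝ) (T : L2Pair →ₗ.[ℂ] L2Pair) : Prop :=
  ∀ f g : Space → Spinor, IsTest f → IsTest g →
    ∀ u : L2Pair, u.fst =ᵐ[volume] f → u.snd =ᵐ[volume] g →
      ∃ v : L2Pair, (u, v) ∈ T.graph ∧
        v.fst =ᵐ[volume] (fun x => ((V x + 1 : ℝ) : ℂ) • f x + sigmaP g x) ∧
        v.snd =ᵐ[volume] (fun x => sigmaP f x + ((V x - 1 : ℝ) : ℂ) • g x)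

end HardyDirac

end

open HardyDirac

noncomputable section

/-! Self-adjointness comes from an explicit resolvent at the energy γ - 1, built from a Schur
complement. Write P = -iσ·∇. The equation (H₀ + V - (γ - 1))(φ, χ) = (F₁, F₂) reads (2 - γ + V)φ +
Pχ = F₁ and Pφ - (γ - V)χ = F₂. As γ > sup V, the second line gives χ = (Pφ - F₂)/(γ - V), and the
first becomes b_γ(η, φ) = ⟨η, F₁⟩ + ⟨Pη/(γ - V), F₂⟩ = ⟨Kη, F⟩ for all test spinors η, where Kη =
(η, Pη/(γ - V)). The Hardy-Dirac inequality bounds K by b_γ (`le_form`), so K extends to the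
abstract completion of the test spinors, and the resolvent is R = KK* - (0 ⊕ 1/(γ - V))
(`exists_resolvent`). The first component of K has range exactly ℋ_{+1} (`mem_formDomain_iff`). An
injective, everywhere defined symmetric R makes R⁻¹ + (γ - 1) self-adjoint
(`isSelfAdjoint_ofResolvent`).

Uniqueness: a self-adjoint extension T acts weakly as H₀ + V (`weakDirac_of_extends`), so the
condition on its domain puts T inside the operator just built, and self-adjoint operators have no
proper self-adjoint extension. Independence of γ: the forms b_γ are mutually bounded
(`exists_form_le_mul_form`).

Coulomb case: with E = x·∇, Λ = σ·L and r = |x|, one has r|σ·∇f| = |(E - Λ)f|, so the kinetic term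
is |(E - Λ)f|² with the weight μ = 1/(r(1 + r)). Completing a square bounds the purely radial part ∫
μ|Ef|² below by ∫ (1/r - 1)|f|², which cancels the potential term. Integrating the cross term by
parts leaves Λ² + 2Λ with weight 1/(r(1 + r)²) and Λ² + Λ with weight 1/(1 + r)²
(`coulomb_radial_inequality`). Here Λ² + Λ = L² ≥ 0, while Λ² + 2Λ ≥ 0 expresses the gap (-2, 0) in
the spectrum of Λ. The gap follows from commutation relations and the integrality of L_z, which
enters through Wirtinger's inequality on circles about the third axis. A cutoff argument then admits
test spinors that do not vanish near the origin. -/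

namespace HardyDirac

/-! ### Self-adjoint operators from injective symmetric resolvents. -/

section Resolvent

variable {E : Type*} [NormedAddCommGroup E] [InnerProductSpace ℂ E]

/-- The graph of `R⁻¹ + l`. -/
def resolventGraph (R : E →ₗ[ℂ] E) (l : ℝ) : Submodule ℂ (E × E) :=
  LinearMap.ker (LinearMap.fst ℂ E E -
    R ∘ₗ (LinearMap.snd ℂ E E - (l : ℂ) • LinearMap.fst ℂ E E))

lemma mem_resolventGraph {R : E →ₗ[ℂ] E} {l : ℝ} {p : E × E} :
    p ∈ resolventGraph R l ↔ p.1 = R (p.2 - (l : ℂ) • p.1) := by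
  simp only [resolventGraph, LinearMap.mem_ker, LinearMap.sub_apply, LinearMap.comp_apply,
    LinearMap.smul_apply, LinearMap.fst_apply, LinearMap.snd_apply, sub_eq_zero]

/-- The operator `R⁻¹ + l`. -/
def ofResolvent (R : E →ₗ[ℂ] E) (l : ℝ) : E →ₗ.[ℂ] E := (resolventGraph R l).toLinearPMap

lemma graph_ofResolvent {R : E →ₗ[ℂ] E} (hinj : Function.Injective R) (l : ℝ) :
    (ofResolvent R l).graph = resolventGraph R l := by
  refine Submodule.toLinearPMap_graph_eq _ fun p hp h0 ↦ ?_
  rw [mem_resolventGraph, h0, smul_zero, sub_zero] at hp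
  exact hinj (by rw [← hp, map_zero])

lemma mem_adjoint_graph [CompleteSpace E] {T : E →ₗ.[ℂ] E} (hT : Dense (T.domain : Set E))
    {p : E × E} :
    p ∈ (T.adjoint).graph ↔ ∀ u v : E, (u, v) ∈ T.graph → inner ℂ v p.1 = inner ℂ u p.2 := by
  rw [LinearPMap.adjoint_graph_eq_graph_adjoint hT, Submodule.mem_adjoint_iff]
  simp only [sub_eq_zero]

/-- The graph consists of the pairs (Rf, f + lRf). Testing an element (u, v) of the adjoint graph
against all of them gives ⟨f, u⟩ = ⟨f, R(v - lu)⟩ for every f, which is membership in the graph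
itself. -/
lemma isSelfAdjoint_ofResolvent [CompleteSpace E] {R : E →ₗ[ℂ] E}
    (hinj : Function.Injective R) (hsymm : ∀ x y, inner ℂ (R x) y = inner ℂ x (R y)) (l : ℝ) :
    IsSelfAdjoint (ofResolvent R l) := by
  have hmem (f : E) : (R f, f + (l : ℂ) • R f) ∈ (ofResolvent R l).graph := by
    rw [graph_ofResolvent hinj, mem_resolventGraph]; simp
  have hdense : Dense ((ofResolvent R l).domain : Set E) := by
    rw [Submodule.dense_iff_topologicalClosure_eq_top, Submodule.topologicalClosure_eq_top_iff,
      Submodule.eq_bot_iff]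
    intro y hy
    rw [Submodule.mem_orthogonal] at hy
    -- For y orthogonal to the range of R, the range element R(Ry) gives ‖Ry‖² = ⟨R(Ry), y⟩ = 0.
    refine hinj ?_
    rw [map_zero, ← inner_self_eq_zero (𝕜 := ℂ), ← hsymm]
    exact hy _ (LinearPMap.mem_domain_of_mem_graph (hmem _))
  rw [LinearPMap.isSelfAdjoint_def]
  refine LinearPMap.eq_of_eq_graph ?_
  ext p
  rw [mem_adjoint_graph hdense]
  constructor
  · intro h
    rw [graph_ofResolvent hinj, mem_resolventGraph]
    refine ext_inner_left ℂ fun f ↦ ?_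
    have := h _ _ (hmem f)
    rw [inner_add_left, inner_smul_left, Complex.conj_ofReal, hsymm, hsymm] at this
    rw [map_sub, map_smul, inner_sub_right, inner_smul_right]
    linear_combination this
  · intro h u v huv
    rw [graph_ofResolvent hinj, mem_resolventGraph] at h huv
    simp only at huv
    have h1 : inner ℂ (R (v - (l : ℂ) • u)) (p.2 - (l : ℂ) • p.1) =
        inner ℂ (v - (l : ℂ) • u) p.1 := by rw [hsymm, ← h]
    rw [← huv] at h1
    simp only [inner_sub_left, inner_sub_right, inner_smul_left, inner_smul_right,
      Complex.conj_ofReal] at h1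
    linear_combination -h1

/-- Taking adjoints reverses inclusions: T ⊆ S gives S = S* ⊆ T* = T. -/
lemma eq_of_isSelfAdjoint_of_graph_le [CompleteSpace E] {S T : E →ₗ.[ℂ] E}
    (hS : IsSelfAdjoint S) (hT : IsSelfAdjoint T) (h : T.graph ≤ S.graph) : T = S := by
  refine LinearPMap.eq_of_eq_graph (le_antisymm h fun p hp ↦ ?_)
  rw [← LinearPMap.isSelfAdjoint_def.1 hS, mem_adjoint_graph hS.dense_domain] at hp
  rw [← LinearPMap.isSelfAdjoint_def.1 hT, mem_adjoint_graph hT.dense_domain]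
  exact fun u v huv ↦ hp u v (h huv)

end Resolvent

/-! ### Hilbert space completion of a semi-inner product space. -/

section FormCompletion

universe u v

/-- The completion is taken abstractly, and `K'` is the extension of `K` by continuity. Since H is
not realised inside G, no closability of the form has to be established. -/
lemma exists_formCompletion {S : Type u} [AddCommGroup S] [Module ℂ S]
    (b : PreInnerProductSpace.Core ℂ S) {G : Type v} [NormedAddCommGroup G]
    [InnerProductSpace ℂ G] [CompleteSpace G] (K : S →ₗ[ℂ] G) (C : ℝ)
    (hC : ∀ f, ‖K f‖ ^ 2 ≤ C * (b.inner f f).re) :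
    ∃ (H : Type u) (_ : NormedAddCommGroup H) (_ : InnerProductSpace ℂ H) (_ : CompleteSpace H)
      (i : S →ₗ[ℂ] H) (K' : H →L[ℂ] G), DenseRange i ∧
        (∀ f g, inner ℂ (i f) (i g) = b.inner f g) ∧ ∀ f, K' (i f) = K f := by
  let : PreInnerProductSpace.Core ℂ S := b
  let : SeminormedAddCommGroup S := InnerProductSpace.Core.toSeminormedAddCommGroup (𝕜 := ℂ)
  let : InnerProductSpace ℂ S := InnerProductSpace.ofCore b
  let i : S →L[ℂ] UniformSpace.Completion S := UniformSpace.Completion.toComplL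
  have hi : DenseRange i := UniformSpace.Completion.denseRange_coe
  have hn : ∃ C', ∀ x, ‖K x‖ ≤ C' * ‖i x‖ := by
    refine ⟨√C, fun f ↦ ?_⟩
    have h2 : ‖i f‖ ^ 2 = (b.inner f f).re := by
      change ‖(f : UniformSpace.Completion S)‖ ^ 2 = _
      rw [UniformSpace.Completion.norm_coe]
      exact norm_sq_eq_re_inner (𝕜 := ℂ) f
    rcases le_or_gt 0 C with h0 | h0
    · refine abs_le_of_sq_le_sq' ?_ (by positivity) |>.2
      rw [mul_pow, Real.sq_sqrt h0, h2]
      exact hC f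
    -- A negative C forces K f = 0, which agrees with the default value `√C = 0`.
    · have := hC f
      rw [← h2] at this
      have h3 : ‖K f‖ ^ 2 ≤ 0 := this.trans (mul_nonpos_of_nonpos_of_nonneg h0.le (sq_nonneg _))
      have : ‖K f‖ = 0 := by nlinarith [norm_nonneg (K f)]
      rw [this]; positivity
  exact ⟨UniformSpace.Completion S, inferInstance, inferInstance, inferInstance, i.toLinearMap,
    K.extendOfNorm i.toLinearMap, hi, fun f g ↦ UniformSpace.Completion.inner_coe f g,
    fun f ↦ LinearMap.extendOfNorm_eq hi hn f⟩

end FormCompletion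

/-! ### Test spinors and the symmetry of -iσ·∇. -/

section TestSpinors

lemma IsTest.add {f g : Space → Spinor} (hf : IsTest f) (hg : IsTest g) : IsTest (f + g) :=
  ⟨hf.1.add hg.1, hf.2.add hg.2⟩

lemma IsTest.const_smul {f : Space → Spinor} (hf : IsTest f) (c : ℂ) : IsTest (c • f) :=
  ⟨hf.1.const_smul c, hf.2.smul_left (f := fun _ ↦ c)⟩

lemma IsTest.differentiable {f : Space → Spinor} (hf : IsTest f) : Differentiable ℝ f :=
  hf.1.differentiable (by simp)

/-- The space `C_c^∞(ℝ³, ℂ²)`. -/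
def testSpinor : Submodule ℂ (Space → Spinor) where
  carrier := {f | IsTest f}
  add_mem' := IsTest.add
  zero_mem' := ⟨contDiff_const, HasCompactSupport.zero⟩
  smul_mem' c _ hf := IsTest.const_smul hf c

/-- A Pauli matrix as a real-linear map on spinors. -/
def pauliCLM (k : Fin 3) : Spinor →L[ℝ] Spinor :=
  (LinearMap.toContinuousLinearMap (Matrix.toEuclideanLin (pauli k))).restrictScalars ℝ

lemma pauliCLM_apply (k : Fin 3) (v : Spinor) :
    pauliCLM k v = Matrix.toEuclideanLin (pauli k) v := rfl

lemma pauli_isHermitian (k : Fin 3) : (pauli k).IsHermitian := by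
  ext i j
  fin_cases k <;> fin_cases i <;> fin_cases j <;>
    simp [pauli, Matrix.conjTranspose_apply]

lemma inner_pauli_left (k : Fin 3) (v w : Spinor) :
    inner ℂ (Matrix.toEuclideanLin (pauli k) v) w =
      inner ℂ v (Matrix.toEuclideanLin (pauli k) w) := by
  conv_lhs => rw [← (pauli_isHermitian k).eq, Matrix.toEuclideanLin_conjTranspose_eq_adjoint,
    LinearMap.adjoint_inner_left]

lemma sigmaGrad_eq (f : Space → Spinor) :
    sigmaGrad f = ∑ k, fun x ↦ pauliCLM k (fderiv ℝ f x (EuclideanSpace.single k 1)) := by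
  ext1 x; simp [sigmaGrad, pauliCLM_apply]

lemma contDiff_fderiv_apply {f : Space → Spinor} (hf : ContDiff ℝ ∞ f) (v : Space) :
    ContDiff ℝ ∞ fun x ↦ fderiv ℝ f x v :=
  (hf.fderiv_right (m := ∞) (by simp)).clm_apply contDiff_const

lemma IsTest.sigmaGrad {f : Space → Spinor} (hf : IsTest f) : IsTest (sigmaGrad f) := by
  rw [sigmaGrad_eq]
  refine testSpinor.sum_mem fun k _ ↦ ⟨?_, ?_⟩
  · exact (pauliCLM k).contDiff.comp (contDiff_fderiv_apply hf.1 _)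
  · exact (hf.2.fderiv_apply ℝ _).comp_left (map_zero _)

lemma IsTest.sigmaP {f : Space → Spinor} (hf : IsTest f) : IsTest (sigmaP f) :=
  hf.sigmaGrad.const_smul _

lemma sigmaGrad_add {f g : Space → Spinor} (hf : IsTest f) (hg : IsTest g) :
    sigmaGrad (f + g) = sigmaGrad f + sigmaGrad g := by
  ext1 x
  simp only [sigmaGrad, fderiv_add hf.differentiable.differentiableAt
    hg.differentiable.differentiableAt, add_apply, map_add,
    Finset.sum_add_distrib, Pi.add_apply]

lemma sigmaGrad_const_smul (f : Space → Spinor) (c : ℂ) :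
    sigmaGrad (c • f) = c • sigmaGrad f := by
  ext1 x
  simp only [sigmaGrad, fderiv_const_smul_field c, Pi.smul_apply, smul_apply,
    map_smul, Finset.smul_sum]

/-- The operator `-i σ·∇` on test spinors. -/
def sigmaPTest : testSpinor →ₗ[ℂ] testSpinor where
  toFun f := ⟨sigmaP f, IsTest.sigmaP f.2⟩
  map_add' f g := by
    ext1
    change (-Complex.I) • sigmaGrad ((f : Space → Spinor) + g) = _
    rw [sigmaGrad_add f.2 g.2, smul_add]; rfl
  map_smul' c f := by
    ext1
    change (-Complex.I) • sigmaGrad (c • (f : Space → Spinor)) = _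
    rw [sigmaGrad_const_smul, smul_comm]; rfl

lemma norm_sigmaP (f : Space → Spinor) (x : Space) : ‖sigmaP f x‖ = ‖sigmaGrad f x‖ := by
  simp [sigmaP, norm_smul]

lemma integrable_inner_of_isTest {f g : Space → Spinor} (hf : Continuous f)
    (hg : Continuous g) (hc : HasCompactSupport f) :
    Integrable fun x ↦ inner ℂ (f x) (g x) := by
  refine (hf.inner hg).integrable_of_hasCompactSupport (hc.mono fun x hx ↦ ?_)
  rw [Function.mem_support] at hx ⊢
  exact fun h ↦ hx (by rw [h, inner_zero_left])

/-- The complex inner product of spinors as a real-bilinear map. -/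
def spinorInner : Spinor →L[ℝ] Spinor →L[ℝ] ℂ :=
  (isBoundedBilinearMap_inner (𝕜 := ℂ) (E := Spinor)).toContinuousLinearMap

lemma integral_inner_fderiv {f g : Space → Spinor} (hf : IsTest f) (hg : IsTest g) (v : Space) :
    ∫ x, inner ℂ (f x) (fderiv ℝ g x v) = - ∫ x, inner ℂ (fderiv ℝ f x v) (g x) :=
  integral_bilinear_fderiv_right_eq_neg_left_of_integrable (B := spinorInner)
    (integrable_inner_of_isTest (contDiff_fderiv_apply hf.1 v).continuous hg.1.continuous
      (hf.2.fderiv_apply ℝ _))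
    (integrable_inner_of_isTest hf.1.continuous (contDiff_fderiv_apply hg.1 v).continuous hf.2)
    (integrable_inner_of_isTest hf.1.continuous hg.1.continuous hf.2)
    (fun _ _ ↦ hf.differentiable.differentiableAt) (fun _ _ ↦ hg.differentiable.differentiableAt)

/-- `-i σ·∇` is symmetric on test spinors. -/
lemma integral_inner_sigmaP {f g : Space → Spinor} (hf : IsTest f) (hg : IsTest g) :
    ∫ x, inner ℂ (sigmaP f x) (g x) = ∫ x, inner ℂ (f x) (sigmaP g x) := by
  have hp (k : Fin 3) {h : Space → Spinor} (hh : IsTest h) :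
      IsTest fun x ↦ Matrix.toEuclideanLin (pauli k) (h x) :=
    ⟨(pauliCLM k).contDiff.comp hh.1, hh.2.comp_left (map_zero (pauliCLM k))⟩
  have hd (k : Fin 3) {h : Space → Spinor} (hh : IsTest h) (x v : Space) :
      fderiv ℝ (fun x ↦ Matrix.toEuclideanLin (pauli k) (h x)) x v =
        Matrix.toEuclideanLin (pauli k) (fderiv ℝ h x v) := by
    have := ((pauliCLM k).hasFDerivAt.comp x hh.differentiable.differentiableAt.hasFDerivAt).fderiv
    exact congrArg (fun L : Space →L[ℝ] Spinor ↦ L v) this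
  have h1 (k : Fin 3) : Integrable fun x ↦ inner ℂ
      (Matrix.toEuclideanLin (pauli k) (fderiv ℝ f x (EuclideanSpace.single k 1))) (g x) := by
    simp_rw [inner_pauli_left]
    exact integrable_inner_of_isTest (contDiff_fderiv_apply hf.1 _).continuous
      (hp k hg).1.continuous (hf.2.fderiv_apply ℝ _)
  have h2 (k : Fin 3) : Integrable fun x ↦ inner ℂ (f x)
      (Matrix.toEuclideanLin (pauli k) (fderiv ℝ g x (EuclideanSpace.single k 1))) := by
    simp_rw [← inner_pauli_left]
    exact integrable_inner_of_isTest (hp k hf).1.continuous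
      (contDiff_fderiv_apply hg.1 _).continuous (hp k hf).2
  simp only [sigmaP, sigmaGrad, inner_smul_left, inner_smul_right, sum_inner, inner_sum,
    integral_const_mul]
  rw [integral_finsetSum _ fun k _ ↦ h1 k, integral_finsetSum _ fun k _ ↦ h2 k,
    Finset.mul_sum, Finset.mul_sum]
  refine Finset.sum_congr rfl fun k _ ↦ ?_
  have h3 := integral_inner_fderiv (hp k hf) hg (EuclideanSpace.single k 1)
  simp only [hd k hf, inner_pauli_left] at h3
  simp only [inner_pauli_left, h3, map_neg, Complex.conj_I]
  ring

end TestSpinors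

/-! ### Multiplication by locally square-integrable and by bounded weights. -/

section Multiplication

lemma LocallyL2.aestronglyMeasurable {a : Space → ℝ} (ha : LocallyL2 a) :
    AEStronglyMeasurable a volume := by
  have h := aestronglyMeasurable_iUnion_iff.2 fun n : ℕ ↦
    (ha _ (isCompact_closedBall (0 : Space) n)).aestronglyMeasurable
  rwa [Metric.iUnion_closedBall_nat, Measure.restrict_univ] at h

lemma LocallyL2.of_bound {a : Space → ℝ} (ha : AEStronglyMeasurable a volume) (C : ℝ)
    (hC : ∀ x, |a x| ≤ C) : LocallyL2 a := fun K hK ↦ by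
  have : IsFiniteMeasure (volume.restrict K) := isFiniteMeasure_restrict.2 hK.measure_lt_top.ne
  exact MemLp.of_bound ha.restrict C (Eventually.of_forall hC)

lemma LocallyL2.const (r : ℝ) : LocallyL2 fun _ ↦ r :=
  .of_bound aestronglyMeasurable_const |r| fun _ ↦ le_rfl

lemma LocallyL2.add {a d : Space → ℝ} (ha : LocallyL2 a) (hd : LocallyL2 d) :
    LocallyL2 fun x ↦ a x + d x := fun K hK ↦ (ha K hK).add (hd K hK)

lemma LocallyL2.sub {a d : Space → ℝ} (ha : LocallyL2 a) (hd : LocallyL2 d) :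
    LocallyL2 fun x ↦ a x - d x := fun K hK ↦ (ha K hK).sub (hd K hK)

lemma LocallyL2.memLp_smul {a : Space → ℝ} (ha : LocallyL2 a) {f : Space → Spinor}
    (hf : Continuous f) (hc : HasCompactSupport f) : MemLp (fun x ↦ (a x : ℂ) • f x) 2 := by
  obtain ⟨C, hC⟩ := hc.exists_bound_of_continuous hf
  have h1 : MemLp (fun x ↦ (a x : ℂ) • f x) 2 (volume.restrict (tsupport f)) := by
    refine (ha _ hc).of_le_mul (c := C) ?_ (Eventually.of_forall fun x ↦ ?_)
    · exact ((Complex.continuous_ofReal.comp_aestronglyMeasurable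
        ha.aestronglyMeasurable).smul hf.aestronglyMeasurable).restrict
    · rw [norm_smul, Complex.norm_real, mul_comm]
      exact mul_le_mul_of_nonneg_right (hC x) (norm_nonneg _)
  rw [← memLp_indicator_iff_restrict (isClosed_tsupport f).measurableSet] at h1
  refine (congrArg (fun g ↦ MemLp g 2 volume) ?_).mp h1
  funext x
  by_cases hx : x ∈ tsupport f
  · rw [Set.indicator_of_mem hx]
  · rw [Set.indicator_of_notMem hx, image_eq_zero_of_notMem_tsupport hx, smul_zero]

/-- Multiplication of test spinors by a real function in `L²_loc`. -/
def mulTest (a : Space → ℝ) (ha : LocallyL2 a) : testSpinor →ₗ[ℂ] L2 where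
  toFun f := (ha.memLp_smul f.2.1.continuous f.2.2).toLp _
  map_add' f g := by
    rw [← MemLp.toLp_add]
    congr 1; funext x; simp
  map_smul' c f := by
    rw [RingHom.id_apply, ← MemLp.toLp_const_smul]
    congr 1; funext x; simp [smul_comm c]

lemma coeFn_mulTest {a : Space → ℝ} (ha : LocallyL2 a) (f : testSpinor) :
    mulTest a ha f =ᵐ[volume] fun x ↦ (a x : ℂ) • (f : Space → Spinor) x :=
  MemLp.coeFn_toLp (ha.memLp_smul f.2.1.continuous f.2.2)

lemma inner_mulTest_eq {a : Space → ℝ} (ha : LocallyL2 a) (f : testSpinor) (u : L2) :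
    inner ℂ (mulTest a ha f) u = ∫ x, inner ℂ ((f : Space → Spinor) x) ((a x : ℂ) • u x) := by
  rw [L2.inner_def]
  refine integral_congr_ae ((coeFn_mulTest ha f).mono fun x hx ↦ ?_)
  simp only [hx, inner_smul_left, inner_smul_right, Complex.conj_ofReal]

lemma inner_mulTest_mulTest {a d : Space → ℝ} (ha : LocallyL2 a) (hd : LocallyL2 d)
    (f g : testSpinor) : inner ℂ (mulTest a ha f) (mulTest d hd g) =
      ∫ x, ((a x * d x : ℝ) : ℂ) * inner ℂ ((f : Space → Spinor) x) ((g : Space → Spinor) x) := by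
  rw [L2.inner_def]
  refine integral_congr_ae ?_
  filter_upwards [coeFn_mulTest ha f, coeFn_mulTest hd g] with x h1 h2
  simp only [h1, h2, inner_smul_left, inner_smul_right, Complex.conj_ofReal]
  push_cast; ring

lemma integrable_mul_inner {a d : Space → ℝ} (ha : LocallyL2 a) (hd : LocallyL2 d)
    (f g : testSpinor) : Integrable fun x ↦ ((a x * d x : ℝ) : ℂ) *
      inner ℂ ((f : Space → Spinor) x) ((g : Space → Spinor) x) := by
  refine (L2.integrable_inner (𝕜 := ℂ) (mulTest a ha f) (mulTest d hd g)).congr ?_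
  filter_upwards [coeFn_mulTest ha f, coeFn_mulTest hd g] with x h1 h2
  simp only [h1, h2, inner_smul_left, inner_smul_right, Complex.conj_ofReal]
  push_cast; ring

lemma LocallyL2.integrable_mul_normSq {a d : Space → ℝ} (ha : LocallyL2 a) (hd : LocallyL2 d)
    (f : testSpinor) : Integrable fun x ↦ a x * d x * ‖(f : Space → Spinor) x‖ ^ 2 := by
  refine (integrable_mul_inner ha hd f f).re.congr (Eventually.of_forall fun x ↦ ?_)
  simp only [inner_self_eq_norm_sq_to_K]
  simp only [← Complex.ofReal_pow, ← Complex.ofReal_mul, RCLike.re_to_complex,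
    Complex.coe_algebraMap, Complex.ofReal_re]

lemma re_inner_mulTest {a d : Space → ℝ} (ha : LocallyL2 a) (hd : LocallyL2 d) (f : testSpinor) :
    (inner ℂ (mulTest a ha f) (mulTest d hd f)).re =
      ∫ x, a x * d x * ‖(f : Space → Spinor) x‖ ^ 2 := by
  rw [inner_mulTest_mulTest, ← RCLike.re_to_complex,
    ← integral_re (integrable_mul_inner ha hd f f)]
  refine integral_congr_ae (Eventually.of_forall fun x ↦ ?_)
  simp only [inner_self_eq_norm_sq_to_K]
  simp only [← Complex.ofReal_pow, ← Complex.ofReal_mul, RCLike.re_to_complex,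
    Complex.coe_algebraMap, Complex.ofReal_re]

lemma norm_mulTest_sq {a : Space → ℝ} (ha : LocallyL2 a) (f : testSpinor) :
    ‖mulTest a ha f‖ ^ 2 = ∫ x, a x * a x * ‖(f : Space → Spinor) x‖ ^ 2 := by
  rw [← re_inner_mulTest ha ha]
  exact norm_sq_eq_re_inner (𝕜 := ℂ) _

/-- Only the product of the two weights matters, so weights may be moved across the inner product.
-/
lemma inner_mulTest_comm {a d a' d' : Space → ℝ} (ha : LocallyL2 a) (hd : LocallyL2 d)
    (ha' : LocallyL2 a') (hd' : LocallyL2 d') (h : ∀ x, a x * d x = a' x * d' x)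
    (f g : testSpinor) :
    inner ℂ (mulTest a ha f) (mulTest d hd g) = inner ℂ (mulTest a' ha' f) (mulTest d' hd' g) := by
  simp only [inner_mulTest_mulTest, h]

/-- The inclusion of the test spinors into `L²`. -/
def inclTest : testSpinor →ₗ[ℂ] L2 := mulTest (fun _ ↦ 1) (.const 1)

lemma coeFn_inclTest (f : testSpinor) : inclTest f =ᵐ[volume] (f : Space → Spinor) :=
  (coeFn_mulTest (.const 1) f).trans (by simp)

lemma inner_inclTest_eq (f : testSpinor) (u : L2) :
    inner ℂ (inclTest f) u = ∫ x, inner ℂ ((f : Space → Spinor) x) (u x) := by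
  simp [inclTest, inner_mulTest_eq]

lemma inner_inclTest_sigmaP (f g : testSpinor) :
    inner ℂ (inclTest (sigmaPTest f)) (inclTest g) =
      inner ℂ (inclTest f) (inclTest (sigmaPTest g)) := by
  simp only [inclTest, inner_mulTest_mulTest, mul_one, Complex.ofReal_one, one_mul]
  exact integral_inner_sigmaP f.2 g.2

/-- A locally integrable weight times an `L²` function vanishes if it is orthogonal to all
test spinors. -/
lemma eq_zero_of_inner_mulTest {a : Space → ℝ} (ha : LocallyL2 a) (hpos : ∀ x, 0 < a x) {w : L2}
    (h : ∀ f : testSpinor, inner ℂ (mulTest a ha f) w = 0) : w = 0 := by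
  have hw := Lp.memLp w
  have key : ∀ᵐ x, (a x : ℂ) • w x = 0 := by
    -- On compact sets both `a` and `w` are square-integrable, so their product is integrable by
    -- Hölder.
    have hloc : LocallyIntegrable (fun x ↦ (a x : ℂ) • w x) volume := by
      rw [locallyIntegrable_iff]
      intro K hK
      exact memLp_one_iff_integrable.1 (show MemLp ((fun x ↦ (a x : ℂ)) • ⇑w) 1 _ from
          (hw.restrict K).smul (p := 2) (q := 2) (r := 1) (ha K hK).ofReal)
    refine ae_eq_zero_of_integral_contDiff_smul_eq_zero hloc fun g hg hgc ↦ ?_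
    refine ext_inner_left ℂ fun v ↦ ?_
    have hint : Integrable fun x ↦ g x • (a x : ℂ) • w x :=
      hloc.integrable_smul_left_of_hasCompactSupport hg.continuous hgc
    rw [inner_zero_right, ← integral_inner hint v]
    have ht : IsTest fun x ↦ g x • v := ⟨hg.smul contDiff_const, hgc.smul_right (f' := fun _ ↦ v)⟩
    have := h ⟨_, ht⟩
    rw [inner_mulTest_eq] at this
    rw [← this]
    refine integral_congr_ae (Eventually.of_forall fun x ↦ ?_)
    simp only [← Complex.coe_smul (g x), inner_smul_left, inner_smul_right, Complex.conj_ofReal]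
    ring
  refine Lp.ext ?_
  filter_upwards [key, Lp.coeFn_zero Spinor 2 (volume : Measure Space)] with x hx h0
  rw [h0]
  exact (smul_eq_zero.1 hx).resolve_left (by exact_mod_cast (hpos x).ne')

lemma memLp_ofReal_smul {a : Space → ℝ} (ha : AEStronglyMeasurable a volume) {C : ℝ}
    (hC : ∀ x, |a x| ≤ C) (u : L2) : MemLp (fun x ↦ (a x : ℂ) • u x) 2 volume :=
  (Lp.memLp u).of_le_mul (c := C)
    ((Complex.continuous_ofReal.comp_aestronglyMeasurable ha).smul (Lp.aestronglyMeasurable u))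
    (Eventually.of_forall fun x ↦ by
      rw [norm_smul, Complex.norm_real]
      exact mul_le_mul_of_nonneg_right (hC x) (norm_nonneg _))

/-- Multiplication of `L²` functions by a bounded real function. -/
def mulL2 (a : Space → ℝ) (ha : AEStronglyMeasurable a volume) (C : ℝ) (hC : ∀ x, |a x| ≤ C) :
    L2 →ₗ[ℂ] L2 where
  toFun u := (memLp_ofReal_smul ha hC u).toLp _
  map_add' u v := by
    rw [← MemLp.toLp_add, MemLp.toLp_eq_toLp_iff]
    filter_upwards [Lp.coeFn_add u v] with x hx
    simp only [hx, Pi.add_apply, smul_add]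
  map_smul' c u := by
    rw [RingHom.id_apply, ← MemLp.toLp_const_smul, MemLp.toLp_eq_toLp_iff]
    filter_upwards [Lp.coeFn_smul c u] with x hx
    simp only [hx, Pi.smul_apply, smul_comm c]

lemma coeFn_mulL2 {a : Space → ℝ} (ha : AEStronglyMeasurable a volume) {C : ℝ}
    (hC : ∀ x, |a x| ≤ C) (u : L2) :
    mulL2 a ha C hC u =ᵐ[volume] fun x ↦ (a x : ℂ) • u x :=
  MemLp.coeFn_toLp (memLp_ofReal_smul ha hC u)

lemma inner_mulL2 {a : Space → ℝ} (ha : AEStronglyMeasurable a volume) {C : ℝ}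
    (hC : ∀ x, |a x| ≤ C) (u v : L2) :
    inner ℂ (mulL2 a ha C hC u) v = inner ℂ u (mulL2 a ha C hC v) := by
  simp only [L2.inner_def]
  refine integral_congr_ae ?_
  filter_upwards [coeFn_mulL2 ha hC u, coeFn_mulL2 ha hC v] with x h1 h2
  simp only [h1, h2, inner_smul_left, inner_smul_right, Complex.conj_ofReal]

/-- Used to cancel the possibly unbounded γ - V on the test spinor against the bounded 1/(γ - V) on
`u`. -/
lemma inner_mulTest_mulL2 {a d e : Space → ℝ} (ha : AEStronglyMeasurable a volume) {C : ℝ}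
    (hC : ∀ x, |a x| ≤ C) (hd : LocallyL2 d) (he : LocallyL2 e) (h : ∀ x, d x * a x = e x)
    (f : testSpinor) (u : L2) :
    inner ℂ (mulTest d hd f) (mulL2 a ha C hC u) = inner ℂ (mulTest e he f) u := by
  simp only [inner_mulTest_eq]
  refine integral_congr_ae ?_
  filter_upwards [coeFn_mulL2 ha hC u] with x h1
  simp only [h1, smul_smul, ← Complex.ofReal_mul, h]

end Multiplication

/-! ### Coercivity of b_γ and comparison for different γ. -/

section FormEstimates

variable {V : Space → ℝ} {c γ γ' : ℝ}

/-- The function `1 / (γ - V)`. -/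
def invGap (V : Space → ℝ) (γ : ℝ) (x : Space) : ℝ := (γ - V x)⁻¹

lemma gap_pos (hb : BddAbove (Set.range V)) (h : ⨆ x, V x < γ) (x : Space) : 0 < γ - V x :=
  sub_pos.2 ((le_ciSup hb x).trans_lt h)

lemma invGap_pos (hb : BddAbove (Set.range V)) (h : ⨆ x, V x < γ) (x : Space) :
    0 < invGap V γ x := inv_pos.2 (gap_pos hb h x)

lemma gap_mul_invGap (hb : BddAbove (Set.range V)) (h : ⨆ x, V x < γ) (x : Space) :
    (γ - V x) * invGap V γ x = 1 := mul_inv_cancel₀ (gap_pos hb h x).ne'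

lemma abs_invGap_le (hb : BddAbove (Set.range V)) (h : ⨆ x, V x < γ) (x : Space) :
    |invGap V γ x| ≤ (γ - ⨆ x, V x)⁻¹ := by
  rw [abs_of_pos (invGap_pos hb h x)]
  exact inv_anti₀ (sub_pos.2 h) (sub_le_sub_left (le_ciSup hb x) _)

lemma aestronglyMeasurable_invGap (hV : LocallyL2 V) (γ : ℝ) :
    AEStronglyMeasurable (invGap V γ) volume :=
  (hV.aestronglyMeasurable.aemeasurable.const_sub γ).inv.aestronglyMeasurable

lemma locallyL2_invGap (hV : LocallyL2 V) (hb : BddAbove (Set.range V)) (h : ⨆ x, V x < γ) :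
    LocallyL2 (invGap V γ) :=
  .of_bound (aestronglyMeasurable_invGap hV γ) _ (abs_invGap_le hb h)

lemma LocallyL2.mul_invGap (hV : LocallyL2 V) (hb : BddAbove (Set.range V))
    (h : ⨆ x, V x < γ) (h' : ⨆ x, V x < γ') :
    LocallyL2 fun x ↦ invGap V γ x * invGap V γ' x := by
  refine .of_bound ((aestronglyMeasurable_invGap hV γ).mul (aestronglyMeasurable_invGap hV γ'))
    ((γ - ⨆ x, V x)⁻¹ * (γ' - ⨆ x, V x)⁻¹) fun x ↦ ?_
  rw [abs_mul]
  exact mul_le_mul (abs_invGap_le hb h x) (abs_invGap_le hb h' x) (abs_nonneg _)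
    (inv_nonneg.2 (sub_pos.2 h).le)

/-- The weighted square norm `∫ a |f|²`. -/
def wNormSq (a : Space → ℝ) (f : testSpinor) : ℝ := ∫ x, a x * ‖(f : Space → Spinor) x‖ ^ 2

lemma LocallyL2.integrable_wNormSq {a : Space → ℝ} (ha : LocallyL2 a) (f : testSpinor) :
    Integrable fun x ↦ a x * ‖(f : Space → Spinor) x‖ ^ 2 := by
  simpa using ha.integrable_mul_normSq (.const 1) f

lemma wNormSq_mono {a d : Space → ℝ} (ha : LocallyL2 a) (hd : LocallyL2 d) (h : ∀ x, a x ≤ d x)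
    (f : testSpinor) : wNormSq a f ≤ wNormSq d f :=
  integral_mono (ha.integrable_wNormSq f) (hd.integrable_wNormSq f)
    fun x ↦ mul_le_mul_of_nonneg_right (h x) (sq_nonneg _)

lemma wNormSq_sub {a d : Space → ℝ} (ha : LocallyL2 a) (hd : LocallyL2 d) (f : testSpinor) :
    wNormSq (fun x ↦ a x - d x) f = wNormSq a f - wNormSq d f := by
  rw [wNormSq, wNormSq, wNormSq, ← integral_sub (ha.integrable_wNormSq f)
    (hd.integrable_wNormSq f)]
  simp only [sub_mul]

lemma wNormSq_const_mul (r : ℝ) (a : Space → ℝ) (f : testSpinor) :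
    wNormSq (fun x ↦ r * a x) f = r * wNormSq a f := by
  simp only [wNormSq, mul_assoc, integral_const_mul]

lemma wNormSq_nonneg {a : Space → ℝ} (h : ∀ x, 0 ≤ a x) (f : testSpinor) : 0 ≤ wNormSq a f :=
  integral_nonneg fun x ↦ mul_nonneg (h x) (sq_nonneg _)

lemma LocallyL2.potential (hV : LocallyL2 V) (r : ℝ) : LocallyL2 fun x ↦ r + V x :=
  (LocallyL2.const r).add hV

lemma form_eq (hV : LocallyL2 V) (hb : BddAbove (Set.range V)) (h : ⨆ x, V x < γ)
    (f : testSpinor) : form V γ f =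
      wNormSq (invGap V γ) (sigmaPTest f) + wNormSq (fun x ↦ 2 - γ + V x) f := by
  rw [wNormSq, wNormSq, ← integral_add ((locallyL2_invGap hV hb h).integrable_wNormSq _)
    ((hV.potential _).integrable_wNormSq _)]
  refine integral_congr_ae (Eventually.of_forall fun x ↦ ?_)
  change ‖sigmaGrad f x‖ ^ 2 / (γ - V x) + _ = (γ - V x)⁻¹ * ‖sigmaP f x‖ ^ 2 + _
  rw [norm_sigmaP, div_eq_inv_mul]

/-- From 1/(γ - V) - 1/(γ' - V) = (γ' - γ)/((γ - V)(γ' - V)). In particular b_γ decreases in γ, with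
an explicit surplus. -/
lemma form_sub_form (hV : LocallyL2 V) (hb : BddAbove (Set.range V)) (h : ⨆ x, V x < γ)
    (h' : ⨆ x, V x < γ') (f : testSpinor) :
    form V γ f - form V γ' f = (γ' - γ) *
      (wNormSq (fun x ↦ invGap V γ x * invGap V γ' x) (sigmaPTest f) +
        wNormSq (fun _ ↦ 1) f) := by
  have h1 : (fun x ↦ invGap V γ x - invGap V γ' x) =
      fun x ↦ (γ' - γ) * (invGap V γ x * invGap V γ' x) := by
    funext x
    have := gap_mul_invGap hb h x
    have := gap_mul_invGap hb h' x
    linear_combination (-invGap V γ x) * gap_mul_invGap hb h' x +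
      invGap V γ' x * gap_mul_invGap hb h x
  have h2 : (fun x ↦ (2 - γ + V x) - (2 - γ' + V x)) = fun x ↦ (γ' - γ) * 1 := by
    funext x; ring
  have e1 := wNormSq_sub (locallyL2_invGap hV hb h) (locallyL2_invGap hV hb h') (sigmaPTest f)
  have e2 := wNormSq_sub (hV.potential (2 - γ)) (hV.potential (2 - γ')) f
  rw [h1, wNormSq_const_mul] at e1
  rw [h2, wNormSq_const_mul] at e2
  rw [form_eq hV hb h, form_eq hV hb h', mul_add, e1, e2]
  ring

/-- `(γ - Γ) / (γ' - Γ)`, the infimum of `(γ - V) / (γ' - V)`. -/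
def gapRatio (V : Space → ℝ) (γ γ' : ℝ) : ℝ := (γ - ⨆ x, V x) / (γ' - ⨆ x, V x)

lemma gapRatio_pos (h : ⨆ x, V x < γ) (h' : ⨆ x, V x < γ') : 0 < gapRatio V γ γ' :=
  div_pos (sub_pos.2 h) (sub_pos.2 h')

lemma gapRatio_le_one (h : ⨆ x, V x < γ) (hle : γ ≤ γ') : gapRatio V γ γ' ≤ 1 :=
  (div_le_one (sub_pos.2 (h.trans_le hle))).2 (sub_le_sub_right hle _)

/-- For γ ≤ γ' the function t ↦ (γ - t)/(γ' - t) is nonincreasing on t ≤ sup V, so its least value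
there is at sup V. -/
lemma gapRatio_mul_invGap_le (hb : BddAbove (Set.range V)) (h : ⨆ x, V x < γ) (hle : γ ≤ γ')
    (x : Space) : gapRatio V γ γ' * invGap V γ x ≤ invGap V γ' x := by
  have h' := h.trans_le hle
  have hx := le_ciSup hb x
  rw [invGap, invGap, ← div_eq_mul_inv, div_le_iff₀ (gap_pos hb h x), inv_mul_eq_div, gapRatio,
    div_le_div_iff₀ (sub_pos.2 h') (gap_pos hb h' x)]
  nlinarith [mul_nonneg (sub_nonneg.2 hle) (sub_nonneg.2 hx)]

lemma form_one_add_nonneg (hA : AssumptionA V c) (f : testSpinor) : 0 ≤ form V (1 + c) f := by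
  refine (hA.hardyDirac f f.2).trans_eq (integral_congr_ae (Eventually.of_forall fun x ↦ ?_))
  ring

/-- `1 / (γ - V)` times `-i σ·∇ f`. -/
def gapP (V : Space → ℝ) (γ : ℝ) (hg : LocallyL2 (invGap V γ)) : testSpinor →ₗ[ℂ] L2 :=
  mulTest (invGap V γ) hg ∘ₗ sigmaPTest

lemma norm_gapP_sq (hg : LocallyL2 (invGap V γ)) (f : testSpinor) :
    ‖gapP V γ hg f‖ ^ 2 = wNormSq (fun x ↦ invGap V γ x * invGap V γ x) (sigmaPTest f) :=
  norm_mulTest_sq hg _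

lemma norm_inclTest_sq (f : testSpinor) : ‖inclTest f‖ ^ 2 = wNormSq (fun _ ↦ 1) f := by
  rw [inclTest, norm_mulTest_sq]; simp [wNormSq]

/-- Assumption (A) says that b_{1+c} ≥ 0; the surplus of b_γ over b_{1+c} controls both f and Pf/(γ
- V) in L². This is the only way the Hardy-Dirac inequality enters, and the reason for γ < 1 + c. -/
lemma le_form (hV : LocallyL2 V) (hA : AssumptionA V c) (hγ : γ ∈ Set.Ioo (⨆ x, V x) (1 + c))
    (hg : LocallyL2 (invGap V γ)) (f : testSpinor) :
    (1 + c - γ) * gapRatio V γ (1 + c) * (‖inclTest f‖ ^ 2 + ‖gapP V γ hg f‖ ^ 2) ≤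
      form V γ f := by
  have hb := hA.bddAbove
  have h1 := form_sub_form hV hb hγ.1 hA.iSup_lt f
  have h2 := form_one_add_nonneg hA f
  have h3 : gapRatio V γ (1 + c) * ‖gapP V γ hg f‖ ^ 2 ≤
      wNormSq (fun x ↦ invGap V γ x * invGap V (1 + c) x) (sigmaPTest f) := by
    rw [norm_gapP_sq, ← wNormSq_const_mul]
    refine wNormSq_mono ?_ (hV.mul_invGap hb hγ.1 hA.iSup_lt) (fun x ↦ ?_) _
    · have := (hV.mul_invGap hb hγ.1 hγ.1)
      exact fun K hK ↦ (this K hK).const_mul _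
    · nlinarith [gapRatio_mul_invGap_le hb hγ.1 hγ.2.le x, invGap_pos hb hγ.1 x]
  have h4 : gapRatio V γ (1 + c) * ‖inclTest f‖ ^ 2 ≤ wNormSq (fun _ ↦ 1) f := by
    rw [norm_inclTest_sq]
    exact mul_le_of_le_one_left (wNormSq_nonneg (fun _ ↦ zero_le_one) f)
      (gapRatio_le_one hγ.1 hγ.2.le)
  have h5 := mul_le_mul_of_nonneg_left (add_le_add h4 h3) (sub_nonneg.2 hγ.2.le)
  linarith

lemma form_nonneg (hV : LocallyL2 V) (hA : AssumptionA V c)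
    (hγ : γ ∈ Set.Ioo (⨆ x, V x) (1 + c)) (f : testSpinor) : 0 ≤ form V γ f :=
  le_trans (mul_nonneg (mul_nonneg (sub_nonneg.2 hγ.2.le) (gapRatio_pos hγ.1 hA.iSup_lt).le)
    (by positivity)) (le_form hV hA hγ (locallyL2_invGap hV hA.bddAbove hγ.1) f)

/-- If γ' ≤ γ, monotonicity gives C = 1. Otherwise the surplus of b_γ over b_{γ'} is bounded by
b_{γ'} itself, through `le_form` at γ'. -/
lemma exists_form_le_mul_form (hV : LocallyL2 V) (hA : AssumptionA V c)
    (hγ : γ ∈ Set.Ioo (⨆ x, V x) (1 + c)) (hγ' : γ' ∈ Set.Ioo (⨆ x, V x) (1 + c)) :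
    ∃ C : ℝ, ∀ f : testSpinor, form V γ f ≤ C * form V γ' f := by
  have hb := hA.bddAbove
  have hsub := form_sub_form hV hb hγ.1 hγ'.1
  rcases le_total γ' γ with hle | hle
  · refine ⟨1, fun f ↦ ?_⟩
    have h1 : 0 ≤ wNormSq (fun x ↦ invGap V γ x * invGap V γ' x) (sigmaPTest f) +
        wNormSq (fun _ ↦ 1) f :=
      add_nonneg (wNormSq_nonneg (fun x ↦ mul_nonneg (invGap_pos hb hγ.1 x).le
        (invGap_pos hb hγ'.1 x).le) _) (wNormSq_nonneg (fun _ ↦ zero_le_one) f)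
    nlinarith [hsub f, sub_nonneg.2 hle]
  · have hg := locallyL2_invGap hV hb hγ'.1
    have hk := gapRatio_pos (V := V) hγ.1 hγ'.1
    set κ := gapRatio V γ γ'
    set δ := (1 + c - γ') * gapRatio V γ' (1 + c)
    have hδ : 0 < δ := mul_pos (sub_pos.2 hγ'.2) (gapRatio_pos hγ'.1 hA.iSup_lt)
    refine ⟨1 + (γ' - γ) * (κ⁻¹ * δ⁻¹), fun f ↦ ?_⟩
    have h3 : κ * wNormSq (fun x ↦ invGap V γ x * invGap V γ' x) (sigmaPTest f) ≤
        ‖gapP V γ' hg f‖ ^ 2 := by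
      rw [norm_gapP_sq, ← wNormSq_const_mul]
      refine wNormSq_mono ?_ (hV.mul_invGap hb hγ'.1 hγ'.1) (fun x ↦ ?_) _
      · exact fun K hK ↦ ((hV.mul_invGap hb hγ.1 hγ'.1) K hK).const_mul _
      · nlinarith [gapRatio_mul_invGap_le hb hγ.1 hle x, invGap_pos hb hγ'.1 x]
    have h4 : κ * wNormSq (fun _ ↦ 1) f ≤ ‖inclTest f‖ ^ 2 := by
      rw [norm_inclTest_sq]
      exact mul_le_of_le_one_left (wNormSq_nonneg (fun _ ↦ zero_le_one) f)
        (gapRatio_le_one hγ.1 hle)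
    have h5 := le_form hV hA hγ' hg f
    have h6 : wNormSq (fun x ↦ invGap V γ x * invGap V γ' x) (sigmaPTest f) +
        wNormSq (fun _ ↦ 1) f ≤ κ⁻¹ * δ⁻¹ * form V γ' f := by
      rw [← mul_inv, inv_mul_eq_div, le_div_iff₀ (mul_pos hk hδ)]
      nlinarith
    have h7 := mul_le_mul_of_nonneg_left h6 (sub_nonneg.2 hle)
    linarith [hsub f]

lemma formDomain_subset (hV : LocallyL2 V) (hA : AssumptionA V c)
    (hγ : γ ∈ Set.Ioo (⨆ x, V x) (1 + c)) (hγ' : γ' ∈ Set.Ioo (⨆ x, V x) (1 + c)) :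
    formDomain V γ' ⊆ formDomain V γ := by
  rintro φ ⟨f, hf, hφ, hc⟩
  refine ⟨f, hf, hφ, ?_⟩
  obtain ⟨C, hC⟩ := exists_form_le_mul_form hV hA hγ hγ'
  have hs (p : ℕ × ℕ) : IsTest (fun x ↦ f p.1 x - f p.2 x) :=
    testSpinor.sub_mem (hf p.1) (hf p.2)
  refine squeeze_zero (fun p ↦ form_nonneg hV hA hγ ⟨_, hs p⟩) (fun p ↦ hC ⟨_, hs p⟩) ?_
  simpa using hc.const_mul C

end FormEstimates

/-! ### The resolvent, the self-adjoint operator and its uniqueness. -/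

section DiracOperator

variable {V : Space → ℝ} {c γ : ℝ}

/-- The sesquilinear form `b_γ`. -/
@[reducible]
def formCore (hV : LocallyL2 V) (hA : AssumptionA V c) (hγ : γ ∈ Set.Ioo (⨆ x, V x) (1 + c)) :
    PreInnerProductSpace.Core ℂ testSpinor where
  -- Both weights sit in the left factor: 2 - γ + V may change sign and has no real square root to
  -- share between the factors.
  inner f g := inner ℂ (gapP V γ (locallyL2_invGap hV hA.bddAbove hγ.1) f)
      (inclTest (sigmaPTest g)) +
    inner ℂ (mulTest _ (hV.potential (2 - γ)) f) (inclTest g)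
  conj_inner_symm f g := by
    rw [map_add, inner_conj_symm, inner_conj_symm]
    have hg := locallyL2_invGap hV hA.bddAbove hγ.1
    exact congrArg₂ (· + ·)
      (inner_mulTest_comm (.const 1) hg hg (.const 1) (fun x ↦ mul_comm _ _) _ _)
      (inner_mulTest_comm (.const 1) (hV.potential _) (hV.potential _) (.const 1)
        (fun x ↦ mul_comm _ _) _ _)
  re_inner_nonneg f := by
    have h := form_nonneg hV hA hγ f
    rw [form_eq hV hA.bddAbove hγ.1] at h
    rw [map_add, RCLike.re_to_complex, RCLike.re_to_complex, gapP, inclTest,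
      LinearMap.comp_apply, re_inner_mulTest, re_inner_mulTest]
    simpa [wNormSq] using h
  add_left f g k := by simp only [map_add, inner_add_left]; ring
  smul_left f g r := by simp only [map_smul, inner_smul_left]; ring

lemma formCore_inner (hV : LocallyL2 V) (hA : AssumptionA V c)
    (hγ : γ ∈ Set.Ioo (⨆ x, V x) (1 + c)) (f g : testSpinor) :
    (formCore hV hA hγ).inner f g =
      inner ℂ (gapP V γ (locallyL2_invGap hV hA.bddAbove hγ.1) f) (inclTest (sigmaPTest g)) +
        inner ℂ (mulTest _ (hV.potential (2 - γ)) f) (inclTest g) := rfl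

lemma re_formCore_inner_self (hV : LocallyL2 V) (hA : AssumptionA V c)
    (hγ : γ ∈ Set.Ioo (⨆ x, V x) (1 + c)) (f : testSpinor) :
    ((formCore hV hA hγ).inner f f).re = form V γ f := by
  rw [form_eq hV hA.bddAbove hγ.1, formCore_inner, Complex.add_re, gapP, inclTest,
    LinearMap.comp_apply, re_inner_mulTest, re_inner_mulTest]
  simp [wNormSq]

lemma weakDirac_iff (hV : LocallyL2 V) (u v : L2Pair) : WeakDirac V u v ↔
    ∀ η : testSpinor,
      inner ℂ (mulTest _ (hV.add (.const 1)) η) u.fst +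
          inner ℂ (inclTest (sigmaPTest η)) u.snd = inner ℂ (inclTest η) v.fst ∧
      inner ℂ (mulTest _ (hV.sub (.const 1)) η) u.snd +
          inner ℂ (inclTest (sigmaPTest η)) u.fst = inner ℂ (inclTest η) v.snd := by
  simp only [inner_mulTest_eq, inner_inclTest_eq]
  exact ⟨fun h η ↦ h η η.2, fun h η hη ↦ h ⟨η, hη⟩⟩

lemma eq_zero_of_inner_inclTest {w : L2} (h : ∀ f, inner ℂ (inclTest f) w = 0) : w = 0 :=
  eq_zero_of_inner_mulTest (.const 1) (fun _ ↦ zero_lt_one) h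

lemma WeakDirac.eq_zero (hV : LocallyL2 V) {v : L2Pair} (h : WeakDirac V 0 v) : v = 0 := by
  rw [weakDirac_iff hV] at h
  simp only [WithLp.zero_fst, WithLp.zero_snd, inner_zero_right, add_zero] at h
  refine WithLp.ofLp_injective 2 (Prod.ext ?_ ?_)
  · exact eq_zero_of_inner_inclTest fun f ↦ (h f).1.symm
  · exact eq_zero_of_inner_inclTest fun f ↦ (h f).2.symm

lemma mulTest_add {a d e : Space → ℝ} (ha : LocallyL2 a) (hd : LocallyL2 d) (he : LocallyL2 e)
    (h : ∀ x, a x + d x = e x) (f : testSpinor) :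
    mulTest a ha f + mulTest d hd f = mulTest e he f := by
  refine Lp.ext ((Lp.coeFn_add _ _).trans ?_)
  filter_upwards [coeFn_mulTest ha f, coeFn_mulTest hd f, coeFn_mulTest he f] with x h1 h2 h3
  rw [Pi.add_apply, h1, h2, h3, ← add_smul, ← Complex.ofReal_add, h]

lemma mulTest_const (r : ℝ) (f : testSpinor) :
    mulTest (fun _ ↦ r) (.const r) f = (r : ℂ) • inclTest f := by
  refine Lp.ext ?_
  filter_upwards [coeFn_mulTest (.const r) f, coeFn_inclTest f,
    Lp.coeFn_smul (r : ℂ) (inclTest f)] with x h1 h2 h3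
  rw [h1, h3, Pi.smul_apply, h2]

/-- Subtracting the energy γ - 1 turns V + 1 and V - 1 into 2 - γ + V and -(γ - V), the weights of
b_γ. -/
lemma weakDirac_shift_iff (hV : LocallyL2 V) (γ : ℝ) (u v : L2Pair) : WeakDirac V u v ↔
    ∀ η : testSpinor,
      inner ℂ (mulTest _ (hV.potential (2 - γ)) η) u.fst +
          inner ℂ (inclTest (sigmaPTest η)) u.snd =
        inner ℂ (inclTest η) (v - ((γ - 1 : ℝ) : ℂ) • u).fst ∧
      inner ℂ (inclTest (sigmaPTest η)) u.fst -
          inner ℂ (mulTest _ ((LocallyL2.const γ).sub hV) η) u.snd =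
        inner ℂ (inclTest η) (v - ((γ - 1 : ℝ) : ℂ) • u).snd := by
  rw [weakDirac_iff hV]
  refine forall_congr' fun η ↦ ?_
  have h1 := mulTest_add (hV.potential (2 - γ)) (.const (γ - 1)) (hV.add (.const 1))
    (fun x ↦ by ring) η
  have h2 := mulTest_add (hV.sub (.const 1)) ((LocallyL2.const γ).sub hV) (.const (γ - 1))
    (fun x ↦ by ring) η
  rw [mulTest_const] at h1 h2
  rw [← h1, ← sub_eq_iff_eq_add] at *
  rw [← eq_sub_iff_add_eq] at h2
  rw [h2]
  simp only [inner_add_left, inner_sub_left, WithLp.sub_fst, WithLp.sub_snd, WithLp.smul_fst,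
    WithLp.smul_snd, inner_sub_right, inner_smul_left, inner_smul_right, Complex.conj_ofReal]
  constructor
  · rintro ⟨e1, e2⟩
    exact ⟨by linear_combination e1, by linear_combination e2⟩
  · rintro ⟨e1, e2⟩
    exact ⟨by linear_combination e1, by linear_combination e2⟩

/-- The map `f ↦ (f, -i σ·∇ f / (γ - V))` on test spinors. -/
def pairTest (V : Space → ℝ) (γ : ℝ) (hg : LocallyL2 (invGap V γ)) : testSpinor →ₗ[ℂ] L2Pair :=
  (WithLp.linearEquiv 2 ℂ (L2 × L2)).symm.toLinearMap ∘ₗ inclTest.prod (gapP V γ hg)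

lemma norm_pairTest_sq_le (hV : LocallyL2 V) (hA : AssumptionA V c)
    (hγ : γ ∈ Set.Ioo (⨆ x, V x) (1 + c)) (hg : LocallyL2 (invGap V γ)) (f : testSpinor) :
    ‖pairTest V γ hg f‖ ^ 2 ≤ ((1 + c - γ) * gapRatio V γ (1 + c))⁻¹ * form V γ f := by
  rw [inv_mul_eq_div, le_div_iff₀
    (mul_pos (sub_pos.2 hγ.2) (gapRatio_pos hγ.1 hA.iSup_lt)), WithLp.prod_norm_sq_eq_of_L2,
    mul_comm]
  exact le_form hV hA hγ hg f

variable {H : Type*} [NormedAddCommGroup H] [InnerProductSpace ℂ H] [CompleteSpace H]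

/-- A b_γ-Cauchy sequence is a Cauchy sequence in H; if it tends to Φ, its L² limit is J Φ.
Injectivity of J plays no role, since only its range is described. -/
lemma mem_formDomain_iff {i : testSpinor →ₗ[ℂ] H} (hi : DenseRange i)
    (hnorm : ∀ f, ‖i f‖ ^ 2 = form V γ f) {J : H →L[ℂ] L2} (hJ : ∀ f, J (i f) = inclTest f)
    (φ : L2) : φ ∈ formDomain V γ ↔ ∃ Φ, J Φ = φ := by
  have hlim (f : ℕ → testSpinor) :
      Tendsto (fun n ↦ eLpNorm (fun x ↦ (f n : Space → Spinor) x - φ x) 2 volume) atTop (𝓝 0) ↔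
        Tendsto (fun n ↦ J (i (f n))) atTop (𝓝 φ) := by
    rw [Lp.tendsto_Lp_iff_tendsto_eLpNorm']
    refine tendsto_congr fun n ↦ eLpNorm_congr_ae ?_
    rw [hJ]
    filter_upwards [coeFn_inclTest (f n)] with x hx
    rw [Pi.sub_apply, hx]
  have hcauchy (f : ℕ → testSpinor) :
      Tendsto (fun p : ℕ × ℕ ↦ form V γ
        (fun x ↦ (f p.1 : Space → Spinor) x - (f p.2 : Space → Spinor) x)) atTop (𝓝 0) ↔
        CauchySeq fun n ↦ i (f n) := by
    rw [cauchySeq_iff_tendsto_dist_atTop_0]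
    have h1 (p : ℕ × ℕ) : form V γ
        (fun x ↦ (f p.1 : Space → Spinor) x - (f p.2 : Space → Spinor) x) =
          dist (i (f p.1)) (i (f p.2)) ^ 2 := by
      rw [dist_eq_norm, ← map_sub, hnorm]; rfl
    rw [funext h1]
    constructor
    · intro h
      simpa [Real.sqrt_sq dist_nonneg] using h.sqrt
    · intro h
      simpa using h.pow 2
  constructor
  · rintro ⟨f, hf, hφ, hc⟩
    have hc' := (hcauchy fun n ↦ ⟨f n, hf n⟩).1 hc
    obtain ⟨Φ, hΦ⟩ := cauchySeq_tendsto_of_complete hc'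
    exact ⟨Φ, tendsto_nhds_unique ((J.continuous.tendsto Φ).comp hΦ)
      ((hlim fun n ↦ ⟨f n, hf n⟩).1 hφ)⟩
  · rintro ⟨Φ, rfl⟩
    obtain ⟨y, hy, hlimy⟩ := mem_closure_iff_seq_limit.1 (hi Φ)
    choose f hf using hy
    obtain rfl : (fun n ↦ i (f n)) = y := funext hf
    exact ⟨fun n ↦ f n, fun n ↦ (f n).2, (hlim f).2 ((J.continuous.tendsto Φ).comp hlimy),
      (hcauchy f).2 hlimy.cauchySeq⟩

/-- The resolvent `(H - (γ - 1))⁻¹` of the Dirac operator. -/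
lemma exists_resolvent (hV : LocallyL2 V) (hA : AssumptionA V c)
    (hγ : γ ∈ Set.Ioo (⨆ x, V x) (1 + c)) :
    ∃ R : L2Pair →ₗ[ℂ] L2Pair, (∀ x y, inner ℂ (R x) y = inner ℂ x (R y)) ∧
      ∀ u v : L2Pair, u = R (v - ((γ - 1 : ℝ) : ℂ) • u) ↔
        u.fst ∈ formDomain V γ ∧ WeakDirac V u v := by
  have hb := hA.bddAbove
  have hg := locallyL2_invGap hV hb hγ.1
  obtain ⟨H, _, _, _, i, K, hi, hinner, hK⟩ := exists_formCompletion (formCore hV hA hγ)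
    (pairTest V γ hg) _ fun f ↦ by
      rw [re_formCore_inner_self]; exact norm_pairTest_sq_le hV hA hγ hg f
  have hnorm (f : testSpinor) : ‖i f‖ ^ 2 = form V γ f := by
    rw [← re_formCore_inner_self hV hA hγ, ← hinner]
    exact norm_sq_eq_re_inner (𝕜 := ℂ) _
  let J : H →L[ℂ] L2 := WithLp.fstL 2 ℂ L2 L2 ∘L K
  let X : H →L[ℂ] L2 := WithLp.sndL 2 ℂ L2 L2 ∘L K
  have hJK (Φ : H) : (K Φ).fst = J Φ := rfl
  have hXK (Φ : H) : (K Φ).snd = X Φ := rfl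
  have hJ (f : testSpinor) : J (i f) = inclTest f := by rw [← hJK, hK]; rfl
  have hX (f : testSpinor) : X (i f) = gapP V γ hg f := by rw [← hXK, hK]; rfl
  have hinv := aestronglyMeasurable_invGap hV γ
  let M := mulL2 (invGap V γ) hinv _ (abs_invGap_le hb hγ.1)
  have hgap := (LocallyL2.const γ).sub hV
  have hM (η : testSpinor) (w : L2) : inner ℂ (mulTest _ hgap η) (M w) = inner ℂ (inclTest η) w :=
    inner_mulTest_mulL2 hinv _ hgap (.const 1) (gap_mul_invGap hb hγ.1) η w
  have hMsymm (v w : L2) : inner ℂ (M v) w = inner ℂ v (M w) := inner_mulL2 _ _ v w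
  have hPX (η : testSpinor) (w : L2) :
      inner ℂ (inclTest (sigmaPTest η)) (M w) = inner ℂ (X (i η)) w := by
    rw [hX]
    exact inner_mulTest_mulL2 hinv _ (.const 1) hg (fun x ↦ one_mul _) _ w
  -- Weakly, P(JΦ) = (γ - V)XΦ. On test spinors this is symmetry of P; both sides are continuous in
  -- Φ.
  have hweak1 (η : testSpinor) (Φ : H) :
      inner ℂ (inclTest (sigmaPTest η)) (J Φ) = inner ℂ (mulTest _ hgap η) (X Φ) := by
    refine hi.induction_on Φ (isClosed_eq (by fun_prop) (by fun_prop)) fun f ↦ ?_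
    rw [hJ, hX, inner_inclTest_sigmaP]
    exact inner_mulTest_comm (.const 1) (.const 1) hgap hg
      (fun x ↦ by rw [gap_mul_invGap hb hγ.1, one_mul]) _ _
  -- The inner product of H is b_γ; by density it keeps its integral expression when one argument is
  -- a test spinor.
  have hweak2 (η : testSpinor) (Φ : H) : inner ℂ (i η) Φ =
      inner ℂ (inclTest (sigmaPTest η)) (X Φ) +
        inner ℂ (mulTest _ (hV.potential (2 - γ)) η) (J Φ) := by
    refine hi.induction_on Φ (isClosed_eq (by fun_prop) (by fun_prop)) fun f ↦ ?_
    rw [hinner, hX, hJ, formCore_inner]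
    congr 1
    exact inner_mulTest_comm hg (.const 1) (.const 1) hg (fun x ↦ mul_comm _ _) _ _
  let N : L2Pair →ₗ[ℂ] L2Pair := (WithLp.linearEquiv 2 ℂ (L2 × L2)).symm.toLinearMap ∘ₗ
    (0 : L2Pair →ₗ[ℂ] L2).prod (M ∘ₗ (WithLp.sndL 2 ℂ L2 L2).toLinearMap)
  have hN1 (F : L2Pair) : (N F).fst = 0 := rfl
  have hN2 (F : L2Pair) : (N F).snd = M F.snd := rfl
  have hinnerP (F G : L2Pair) : inner ℂ F G = inner ℂ F.fst G.fst + inner ℂ F.snd G.snd := rfl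
  -- K*F is the Riesz representative of η ↦ ⟨Kη, F⟩, i.e. the solution of the Schur complement
  -- equation, and N supplies the term -F₂/(γ - V) of the lower component.
  refine ⟨(K ∘L K.adjoint).toLinearMap - N, fun F G ↦ ?_, fun u v ↦ ?_⟩
  · have h1 : inner ℂ (N F) G = inner ℂ F (N G) := by
      rw [hinnerP, hinnerP, hN1, hN1, hN2, hN2, hMsymm]; simp
    simp only [LinearMap.sub_apply, inner_sub_left, inner_sub_right, h1,
      ContinuousLinearMap.coe_coe, ContinuousLinearMap.comp_apply]
    rw [← ContinuousLinearMap.adjoint_inner_right K, ContinuousLinearMap.adjoint_inner_left K]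
  · rw [mem_formDomain_iff hi hnorm hJ, weakDirac_shift_iff hV γ]
    set F := v - ((γ - 1 : ℝ) : ℂ) • u
    have hadj (η : testSpinor) : inner ℂ (i η) (K.adjoint F) =
        inner ℂ (inclTest η) F.fst + inner ℂ (X (i η)) F.snd := by
      rw [ContinuousLinearMap.adjoint_inner_right, hinnerP, hJK, hXK, hJ]
    constructor
    · intro hu
      have hu1 : u.fst = J (K.adjoint F) := by
        rw [hu]; simp [hN1, hJK]
      have hu2 : u.snd = X (K.adjoint F) - M F.snd := by
        rw [hu]; simp [hN2, hXK]
      refine ⟨⟨_, hu1.symm⟩, fun η ↦ ?_⟩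
      rw [hu1, hu2, inner_sub_right, inner_sub_right, hPX, hM, hweak1]
      refine ⟨?_, by ring⟩
      have h1 := hadj η
      rw [hweak2] at h1
      linear_combination h1
    · rintro ⟨⟨Φ, hΦ⟩, hw⟩
      -- The second weak equation, with the factor γ - V > 0 cancelled, determines the lower
      -- component.
      have hu2 : X Φ - u.snd - M F.snd = 0 := by
        refine eq_zero_of_inner_mulTest hgap (gap_pos hb hγ.1) fun η ↦ ?_
        have := (hw η).2
        rw [← hΦ, hweak1] at this
        rw [inner_sub_right, inner_sub_right, hM]
        linear_combination this
      rw [sub_eq_zero, sub_eq_iff_eq_add] at hu2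
      -- With the lower component eliminated, the first weak equation is ⟨iη, Φ⟩ = ⟨K(iη), F⟩ for
      -- all η, and the iη are dense in H.
      have hΦ' : Φ = K.adjoint F := by
        refine hi.eq_of_inner_right ℂ fun η ↦ ?_
        have := (hw η).1
        rw [hadj, hweak2, hu2, inner_add_right, hPX, hΦ]
        linear_combination this
      refine WithLp.ofLp_injective 2 (Prod.ext ?_ ?_)
      · change u.fst = _
        rw [← hΦ, hΦ']; simp [hN1, hJK]
      · change u.snd = _
        rw [← sub_eq_iff_eq_add'.2 hu2, hΦ']; simp [hN2, hXK]

lemma isTest_mem_formDomain {f : Space → Spinor} (hf : IsTest f) {φ : L2}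
    (h : φ =ᵐ[volume] f) : φ ∈ formDomain V γ := by
  refine ⟨fun _ ↦ f, fun _ ↦ hf, ?_, ?_⟩
  · have : eLpNorm (fun x ↦ f x - φ x) 2 volume = 0 := by
      rw [eLpNorm_congr_ae (g := fun _ ↦ 0)]
      · simp
      · filter_upwards [h] with x hx
        rw [hx, sub_self]
    simp [this]
  · have h0 : sigmaGrad (fun _ ↦ 0) = fun _ ↦ 0 := by funext x; simp [sigmaGrad]
    simp [form, h0]

lemma eq_inclTest {f : testSpinor} {φ : L2} (h : φ =ᵐ[volume] (f : Space → Spinor)) :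
    φ = inclTest f := Lp.ext (h.trans (coeFn_inclTest f).symm)

lemma weakDirac_test (hV : LocallyL2 V) (f g : testSpinor) :
    WeakDirac V (WithLp.toLp 2 (inclTest f, inclTest g))
      (WithLp.toLp 2 (mulTest _ (hV.add (.const 1)) f + inclTest (sigmaPTest g),
        mulTest _ (hV.sub (.const 1)) g + inclTest (sigmaPTest f))) := by
  rw [weakDirac_iff hV]
  intro η
  simp only [WithLp.toLp_fst, WithLp.toLp_snd, inner_add_right, inner_inclTest_sigmaP]
  exact ⟨congrArg (· + _) (inner_mulTest_comm _ (.const 1) (.const 1) _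
    (fun x ↦ mul_comm _ _) _ _), congrArg (· + _) (inner_mulTest_comm _ (.const 1) (.const 1) _
    (fun x ↦ mul_comm _ _) _ _)⟩

lemma extendsDirac_iff (hV : LocallyL2 V) (T : L2Pair →ₗ.[ℂ] L2Pair) : ExtendsDirac V T ↔
    ∀ f g : testSpinor, (WithLp.toLp 2 (inclTest f, inclTest g),
      WithLp.toLp 2 (mulTest _ (hV.add (.const 1)) f + inclTest (sigmaPTest g),
        mulTest _ (hV.sub (.const 1)) g + inclTest (sigmaPTest f))) ∈ T.graph := by
  have hsub (f g : testSpinor) (φ : L2) : φ =ᵐ[volume] (fun x ↦ sigmaP f x +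
      ((V x - 1 : ℝ) : ℂ) • (g : Space → Spinor) x) ↔
        φ = mulTest _ (hV.sub (.const 1)) g + inclTest (sigmaPTest f) := by
    have key : mulTest _ (hV.sub (.const 1)) g + inclTest (sigmaPTest f) =ᵐ[volume]
        (fun x ↦ sigmaP f x + ((V x - 1 : ℝ) : ℂ) • (g : Space → Spinor) x) := by
      filter_upwards [coeFn_mulTest (hV.sub (.const 1)) g, coeFn_inclTest (sigmaPTest f),
        Lp.coeFn_add (mulTest _ (hV.sub (.const 1)) g) (inclTest (sigmaPTest f))] with x h1 h2 h3
      rw [h3, Pi.add_apply, h1, h2, add_comm]; rfl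
    exact ⟨fun h ↦ Lp.ext (h.trans key.symm), fun h ↦ h ▸ key⟩
  have hadd (f g : testSpinor) (φ : L2) : φ =ᵐ[volume] (fun x ↦
      ((V x + 1 : ℝ) : ℂ) • (f : Space → Spinor) x + sigmaP g x) ↔
        φ = mulTest _ (hV.add (.const 1)) f + inclTest (sigmaPTest g) := by
    have key : mulTest _ (hV.add (.const 1)) f + inclTest (sigmaPTest g) =ᵐ[volume]
        (fun x ↦ ((V x + 1 : ℝ) : ℂ) • (f : Space → Spinor) x + sigmaP g x) := by
      filter_upwards [coeFn_mulTest (hV.add (.const 1)) f, coeFn_inclTest (sigmaPTest g),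
        Lp.coeFn_add (mulTest _ (hV.add (.const 1)) f) (inclTest (sigmaPTest g))] with x h1 h2 h3
      rw [h3, Pi.add_apply, h1, h2]; rfl
    exact ⟨fun h ↦ Lp.ext (h.trans key.symm), fun h ↦ h ▸ key⟩
  constructor
  · intro h f g
    obtain ⟨v, hv, h1, h2⟩ := h f g f.2 g.2 (WithLp.toLp 2 (inclTest f, inclTest g))
      (coeFn_inclTest f) (coeFn_inclTest g)
    rw [hadd f g] at h1
    rw [hsub f g] at h2
    convert hv
    · exact h1.symm
    · exact h2.symm
  · intro h f g hf hg u hu1 hu2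
    have hu : u = WithLp.toLp 2 (inclTest ⟨f, hf⟩, inclTest ⟨g, hg⟩) :=
      WithLp.ofLp_injective 2 (Prod.ext (eq_inclTest (f := ⟨f, hf⟩) hu1)
        (eq_inclTest (f := ⟨g, hg⟩) hu2))
    exact ⟨_, hu ▸ h ⟨f, hf⟩ ⟨g, hg⟩, (hadd ⟨f, hf⟩ ⟨g, hg⟩ _).2 rfl,
      (hsub ⟨f, hf⟩ ⟨g, hg⟩ _).2 rfl⟩

/-- T = T* lies in the adjoint of the operator on test spinors; testing against (η, 0) and (0, η)
yields the two weak equations. -/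
lemma weakDirac_of_extends (hV : LocallyL2 V) {T : L2Pair →ₗ.[ℂ] L2Pair} (hT : IsSelfAdjoint T)
    (hext : ExtendsDirac V T) {u v : L2Pair} (huv : (u, v) ∈ T.graph) : WeakDirac V u v := by
  rw [extendsDirac_iff hV] at hext
  rw [← LinearPMap.isSelfAdjoint_def.1 hT, mem_adjoint_graph hT.dense_domain] at huv
  rw [weakDirac_iff hV]
  intro η
  have h1 := huv _ _ (hext η 0)
  have h2 := huv _ _ (hext 0 η)
  simp only [map_zero, add_zero, zero_add, WithLp.prod_inner_apply, inner_zero_left] at h1 h2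
  exact ⟨h1, (add_comm _ _).trans h2⟩

lemma exists_diracOperator (hV : LocallyL2 V) (hA : AssumptionA V c)
    (hγ : γ ∈ Set.Ioo (⨆ x, V x) (1 + c)) :
    ∃ H : L2Pair →ₗ.[ℂ] L2Pair, IsDiracOperator V γ H ∧ IsSelfAdjoint H ∧ ExtendsDirac V H ∧
      ∀ T : L2Pair →ₗ.[ℂ] L2Pair, IsSelfAdjoint T → ExtendsDirac V T →
        (∀ u ∈ T.domain, u.fst ∈ formDomain V γ) → T = H := by
  obtain ⟨R, hsymm, hR⟩ := exists_resolvent hV hA hγ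
  have hinj : Function.Injective R := by
    rw [← LinearMap.ker_eq_bot, LinearMap.ker_eq_bot']
    intro F hF
    -- If RF = 0, then (0, F) satisfies the weak equation, so F = 0.
    exact WeakDirac.eq_zero hV ((hR 0 F).1 (by rw [smul_zero, sub_zero, hF])).2
  have hdirac : IsDiracOperator V γ (ofResolvent R (γ - 1)) := fun u v ↦ by
    rw [graph_ofResolvent hinj, mem_resolventGraph]
    exact hR u v
  have hself := isSelfAdjoint_ofResolvent hinj hsymm (γ - 1)
  refine ⟨_, hdirac, hself, ?_, fun T hT hext hdom ↦ ?_⟩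
  · rw [extendsDirac_iff hV]
    exact fun f g ↦ (hdirac _ _).2
      ⟨isTest_mem_formDomain f.2 (coeFn_inclTest f), weakDirac_test hV f g⟩
  · refine eq_of_isSelfAdjoint_of_graph_le hself hT fun p hp ↦ ?_
    exact (hdirac p.1 p.2).2 ⟨hdom _ (LinearPMap.mem_domain_of_mem_graph hp),
      weakDirac_of_extends hV hT hext hp⟩

end DiracOperator

/-! ### Derivatives along linear vector fields, away from the origin. -/

section PuncturedTest

/-- Smooth compactly supported scalar functions that vanish near the origin. -/
def puncturedTest : Submodule ℂ (Space → ℂ) where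
  carrier := {a | ContDiff ℝ ∞ a ∧ HasCompactSupport a ∧ a =ᶠ[𝓝 0] 0}
  add_mem' ha hb := ⟨ha.1.add hb.1, ha.2.1.add hb.2.1, by
    simpa using ha.2.2.add hb.2.2⟩
  zero_mem' := ⟨contDiff_const, HasCompactSupport.zero, EventuallyEq.rfl⟩
  smul_mem' c a ha := ⟨ha.1.const_smul c, ha.2.1.smul_left (f := fun _ ↦ c), by
    simpa using ha.2.2.const_smul c⟩

/-- The derivative of a function along the linear vector field `B`. -/
def lieDeriv (B : Space →L[ℝ] Space) (a : Space → ℂ) (x : Space) : ℂ := fderiv ℝ a x (B x)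

lemma lieDeriv_mem (B : Space →L[ℝ] Space) {a : Space → ℂ} (ha : a ∈ puncturedTest) :
    lieDeriv B a ∈ puncturedTest := by
  refine ⟨(ha.1.fderiv_right (m := ∞) (by simp)).clm_apply B.contDiff, ?_, ?_⟩
  · exact (ha.2.1.fderiv ℝ).mono fun x hx h ↦ hx (by rw [lieDeriv, h]; rfl)
  · filter_upwards [ha.2.2.fderiv (𝕜 := ℝ)] with x hx
    have h0 : fderiv ℝ (0 : Space → ℂ) x = 0 := fderiv_const_apply 0
    rw [lieDeriv, hx, h0]; rfl

lemma differentiableAt_of_mem {a : Space → ℂ} (ha : a ∈ puncturedTest) (x : Space) :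
    DifferentiableAt ℝ a x := (ha.1.differentiable (by simp)).differentiableAt

/-- The derivative along `B`, as an operator on `puncturedTest`. -/
def lieOp (B : Space →L[ℝ] Space) : puncturedTest →ₗ[ℂ] puncturedTest where
  toFun a := ⟨lieDeriv B a, lieDeriv_mem B a.2⟩
  map_add' a b := by
    ext x
    change fderiv ℝ ((a : Space → ℂ) + (b : Space → ℂ)) x (B x) = _
    rw [fderiv_add (differentiableAt_of_mem a.2 x) (differentiableAt_of_mem b.2 x)]; rfl
  map_smul' c a := by
    ext x
    change fderiv ℝ (c • (a : Space → ℂ)) x (B x) = _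
    rw [fderiv_const_smul_field c]; rfl

lemma lieOp_apply (B : Space →L[ℝ] Space) (a : puncturedTest) (x : Space) :
    (lieOp B a : Space → ℂ) x = fderiv ℝ (a : Space → ℂ) x (B x) := rfl

lemma lieOp_lieOp_apply (B C : Space →L[ℝ] Space) (a : puncturedTest) (x : Space) :
    (lieOp B (lieOp C a) : Space → ℂ) x =
      fderiv ℝ (fderiv ℝ (a : Space → ℂ)) x (B x) (C x) +
        fderiv ℝ (a : Space → ℂ) x (C (B x)) := by
  have h1 : DifferentiableAt ℝ (fderiv ℝ (a : Space → ℂ)) x :=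
    ((a.2.1.fderiv_right (m := ∞) (by simp)).differentiable (by simp)).differentiableAt
  have h2 := (h1.hasFDerivAt.clm_apply (C.hasFDerivAt (x := x))).fderiv
  rw [lieOp_apply]
  change fderiv ℝ (fun y ↦ fderiv ℝ (a : Space → ℂ) y (C y)) x (B x) = _
  rw [h2]
  simp [add_comm]

/-- The second derivatives cancel by symmetry. What remains reverses the order of composition: B ↦
`lieOp B` is an antihomomorphism of Lie algebras. -/
lemma lieOp_commutator (B C : Space →L[ℝ] Space) (a : puncturedTest) :
    lieOp B (lieOp C a) - lieOp C (lieOp B a) = lieOp (C ∘L B - B ∘L C) a := by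
  ext x
  have hs : IsSymmSndFDerivAt ℝ (a : Space → ℂ) x :=
    a.2.1.contDiffAt.isSymmSndFDerivAt (by simp [ENat.LEInfty.out])
  change (lieOp B (lieOp C a) : Space → ℂ) x - (lieOp C (lieOp B a) : Space → ℂ) x = _
  rw [lieOp_lieOp_apply, lieOp_lieOp_apply, hs.eq, lieOp_apply]
  simp

/-- The divergence of the linear vector field `B`. -/
def divergence (B : Space →L[ℝ] Space) : ℝ := ∑ k, B (EuclideanSpace.single k 1) k

lemma fderiv_apply_eq_sum {F : Type*} [NormedAddCommGroup F] [NormedSpace ℝ F]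
    (L : Space →L[ℝ] F) (y : Space) : L y = ∑ k, y k • L (EuclideanSpace.single k 1) := by
  conv_lhs => rw [← (EuclideanSpace.basisFun (Fin 3) ℝ).sum_repr y]
  simp

/-- Integration by parts in each coordinate: only the diagonal entry of B is differentiated. -/
lemma integral_lieDeriv (B : Space →L[ℝ] Space) {g : Space → ℂ} (hg : ContDiff ℝ ∞ g)
    (hc : HasCompactSupport g) :
    ∫ x, lieDeriv B g x = -(divergence B : ℂ) * ∫ x, g x := by
  have hd (k : Fin 3) : Continuous fun x ↦ fderiv ℝ g x (EuclideanSpace.single k 1) :=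
    (hg.continuous_fderiv (by simp)).clm_apply continuous_const
  have hdc (k : Fin 3) : HasCompactSupport fun x ↦ fderiv ℝ g x (EuclideanSpace.single k 1) :=
    hc.fderiv_apply ℝ _
  let P (k : Fin 3) : Space →L[ℝ] ℂ :=
    Complex.ofRealCLM ∘L (EuclideanSpace.proj k : Space →L[ℝ] ℝ) ∘L B
  have hP (k : Fin 3) (x : Space) : P k x = ((B x k : ℝ) : ℂ) := rfl
  have hint (k : Fin 3) :
      Integrable fun x ↦ P k x * fderiv ℝ g x (EuclideanSpace.single k 1) :=
    ((P k).continuous.mul (hd k)).integrable_of_hasCompactSupport ((hdc k).mul_left)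
  have h1 (k : Fin 3) : ∫ x, P k x * fderiv ℝ g x (EuclideanSpace.single k 1) =
      -((B (EuclideanSpace.single k 1) k : ℝ) : ℂ) * ∫ x, g x := by
    rw [integral_mul_fderiv_eq_neg_fderiv_mul_of_integrable _ (hint k) _
      (fun x _ ↦ (P k).differentiableAt)
      (fun x _ ↦ (hg.differentiable (by simp)).differentiableAt)]
    · simp only [ContinuousLinearMap.fderiv, hP, integral_const_mul, neg_mul]
    · simp only [ContinuousLinearMap.fderiv]
      exact (hg.continuous.integrable_of_hasCompactSupport hc).const_mul _
    · exact ((P k).continuous.mul hg.continuous).integrable_of_hasCompactSupport hc.mul_left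
  have h2 (x : Space) : lieDeriv B g x =
      ∑ k, P k x * fderiv ℝ g x (EuclideanSpace.single k 1) := by
    rw [lieDeriv, fderiv_apply_eq_sum (fderiv ℝ g x) (B x)]
    simp [hP]
  simp_rw [h2]
  rw [integral_finsetSum _ fun k _ ↦ hint k]
  simp_rw [h1]
  rw [← Finset.sum_mul, divergence, Complex.ofReal_sum, Finset.sum_neg_distrib]

/-- The inclusion of `puncturedTest` into `L²(ℝ³, ℂ)`. -/
def puncturedIncl : puncturedTest →ₗ[ℂ] Lp ℂ 2 (volume : Measure Space) where
  toFun a := (a.2.1.continuous.memLp_of_hasCompactSupport a.2.2.1).toLp _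
  map_add' _ _ := rfl
  map_smul' _ _ := rfl

lemma coeFn_puncturedIncl (a : puncturedTest) :
    puncturedIncl a =ᵐ[volume] (a : Space → ℂ) :=
  MemLp.coeFn_toLp (a.2.1.continuous.memLp_of_hasCompactSupport a.2.2.1)

lemma inner_puncturedIncl (a b : puncturedTest) :
    inner ℂ (puncturedIncl a) (puncturedIncl b) =
      ∫ x, inner ℂ ((a : Space → ℂ) x) ((b : Space → ℂ) x) := by
  rw [L2.inner_def]
  refine integral_congr_ae ?_
  filter_upwards [coeFn_puncturedIncl a, coeFn_puncturedIncl b] with x h1 h2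
  rw [h1, h2]

lemma hasCompactSupport_inner {a : Space → ℂ} (ha : HasCompactSupport a) (b : Space → ℂ) :
    HasCompactSupport fun x ↦ inner ℂ (a x) (b x) :=
  ha.mono fun x hx h ↦ hx (by simp only [h, inner_zero_left])

lemma integrable_inner_puncturedTest (a b : puncturedTest) :
    Integrable fun x ↦ inner ℂ ((a : Space → ℂ) x) ((b : Space → ℂ) x) :=
  (a.2.1.continuous.inner b.2.1.continuous).integrable_of_hasCompactSupport
    (hasCompactSupport_inner a.2.2.1 b)

lemma inner_lieOp_add (B : Space →L[ℝ] Space) (a b : puncturedTest) :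
    inner ℂ (puncturedIncl (lieOp B a)) (puncturedIncl b) +
      inner ℂ (puncturedIncl a) (puncturedIncl (lieOp B b)) =
        -(divergence B : ℂ) * inner ℂ (puncturedIncl a) (puncturedIncl b) := by
  simp only [inner_puncturedIncl]
  rw [← integral_lieDeriv B (a.2.1.inner ℂ b.2.1) (hasCompactSupport_inner a.2.2.1 b),
    ← integral_add (integrable_inner_puncturedTest _ _) (integrable_inner_puncturedTest _ _)]
  refine integral_congr_ae (Eventually.of_forall fun x ↦ ?_)
  simp only [lieDeriv, lieOp_apply]
  rw [fderiv_inner_apply ℂ (differentiableAt_of_mem a.2 x) (differentiableAt_of_mem b.2 x),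
    add_comm]

end PuncturedTest

/-! ### Radial multipliers and the Euler operator. -/

section RadialMultiplier

lemma radial_mul_mem {h : ℝ → ℝ} (hh : ContDiffOn ℝ ∞ h (Set.Ioi 0)) {a : Space → ℂ}
    (ha : a ∈ puncturedTest) : (fun x ↦ ((h ‖x‖ : ℝ) : ℂ) * a x) ∈ puncturedTest := by
  have h0 : (fun x ↦ ((h ‖x‖ : ℝ) : ℂ) * a x) =ᶠ[𝓝 0] 0 := by
    filter_upwards [ha.2.2] with x hx
    rw [hx, Pi.zero_apply, mul_zero]
  refine ⟨contDiff_iff_contDiffAt.2 fun x ↦ ?_, ha.2.1.mul_left, h0⟩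
  rcases eq_or_ne x 0 with rfl | hx
  · exact contDiffAt_const.congr_of_eventuallyEq h0
  · refine ContDiffAt.mul ?_ ha.1.contDiffAt
    exact Complex.ofRealCLM.contDiff.contDiffAt.comp x
      ((hh.contDiffAt (Ioi_mem_nhds (norm_pos_iff.2 hx))).comp x (contDiffAt_norm ℝ hx))

/-- Multiplication by the radial function `h(|x|)`. -/
def radMul (h : ℝ → ℝ) (hh : ContDiffOn ℝ ∞ h (Set.Ioi 0)) :
    puncturedTest →ₗ[ℂ] puncturedTest where
  toFun a := ⟨_, radial_mul_mem hh a.2⟩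
  map_add' a b := by ext x; exact mul_add _ _ _
  map_smul' c a := by ext x; exact mul_left_comm _ _ _

lemma radMul_apply {h : ℝ → ℝ} (hh : ContDiffOn ℝ ∞ h (Set.Ioi 0)) (a : puncturedTest)
    (x : Space) : (radMul h hh a : Space → ℂ) x = ((h ‖x‖ : ℝ) : ℂ) * (a : Space → ℂ) x := rfl

lemma puncturedTest_apply_zero (a : puncturedTest) : (a : Space → ℂ) 0 = 0 :=
  a.2.2.2.eq_of_nhds

lemma inner_radMul {h k h' k' : ℝ → ℝ} (hh : ContDiffOn ℝ ∞ h (Set.Ioi 0))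
    (hk : ContDiffOn ℝ ∞ k (Set.Ioi 0)) (hh' : ContDiffOn ℝ ∞ h' (Set.Ioi 0))
    (hk' : ContDiffOn ℝ ∞ k' (Set.Ioi 0)) (heq : ∀ r, 0 < r → h r * k r = h' r * k' r)
    (a b : puncturedTest) :
    inner ℂ (puncturedIncl (radMul h hh a)) (puncturedIncl (radMul k hk b)) =
      inner ℂ (puncturedIncl (radMul h' hh' a)) (puncturedIncl (radMul k' hk' b)) := by
  simp only [inner_puncturedIncl, radMul_apply]
  refine integral_congr_ae (Eventually.of_forall fun x ↦ ?_)
  rcases eq_or_ne x 0 with rfl | hx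
  · simp [puncturedTest_apply_zero]
  · have := congrArg (fun t : ℝ ↦ (t : ℂ)) (heq _ (norm_pos_iff.2 hx))
    simp only [Complex.ofReal_mul] at this
    simp only [RCLike.inner_apply, map_mul, Complex.conj_ofReal]
    linear_combination ((b : Space → ℂ) x * (starRingEnd ℂ) ((a : Space → ℂ) x)) * this

lemma hasFDerivAt_norm_of_ne {x : Space} (hx : x ≠ 0) :
    HasFDerivAt (fun y : Space ↦ ‖y‖) (‖x‖⁻¹ • innerSL ℝ x) x := by
  have h := (hasStrictFDerivAt_norm_sq x).hasFDerivAt.sqrt (by simpa using hx)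
  simp only [Real.sqrt_sq (norm_nonneg _)] at h
  refine h.congr_fderiv ?_
  rw [two_smul ℕ, ← two_smul ℝ, smul_smul]
  congr 1
  field_simp

lemma lieOp_radMul_apply {h h' : ℝ → ℝ} (hh : ContDiffOn ℝ ∞ h (Set.Ioi 0))
    (hd : ∀ r, 0 < r → HasDerivAt h (h' r) r) (B : Space →L[ℝ] Space) (a : puncturedTest)
    {x : Space} (hx : x ≠ 0) : (lieOp B (radMul h hh a) : Space → ℂ) x =
      ((h ‖x‖ : ℝ) : ℂ) * (lieOp B a : Space → ℂ) x +
        ((h' ‖x‖ * (‖x‖⁻¹ * inner ℝ x (B x)) : ℝ) : ℂ) * (a : Space → ℂ) x := by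
  have h1 : HasFDerivAt (fun y : Space ↦ ((h ‖y‖ : ℝ) : ℂ))
      (Complex.ofRealCLM ∘L (h' ‖x‖ • (‖x‖⁻¹ • innerSL ℝ x))) x :=
    Complex.ofRealCLM.hasFDerivAt.comp x
      ((hd _ (norm_pos_iff.2 hx)).comp_hasFDerivAt x (hasFDerivAt_norm_of_ne hx))
  have h2 := (h1.mul (differentiableAt_of_mem a.2 x).hasFDerivAt).fderiv
  rw [lieOp_apply]
  change fderiv ℝ ((fun y ↦ ((h ‖y‖ : ℝ) : ℂ)) * (a : Space → ℂ)) x (B x) = _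
  rw [h2, lieOp_apply]
  simp [mul_comm]

lemma hasDerivAt_of_contDiffOn {h : ℝ → ℝ} (hh : ContDiffOn ℝ ∞ h (Set.Ioi 0)) {r : ℝ}
    (hr : 0 < r) : HasDerivAt h (deriv h r) r :=
  ((hh.contDiffAt (Ioi_mem_nhds hr)).differentiableAt (by simp)).hasDerivAt

lemma lieOp_radMul {h : ℝ → ℝ} (hh : ContDiffOn ℝ ∞ h (Set.Ioi 0)) {B : Space →L[ℝ] Space}
    (hB : ∀ x, inner ℝ x (B x) = 0) (a : puncturedTest) :
    lieOp B (radMul h hh a) = radMul h hh (lieOp B a) := by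
  ext x
  rcases eq_or_ne x 0 with rfl | hx
  · rw [puncturedTest_apply_zero, puncturedTest_apply_zero]
  · rw [lieOp_radMul_apply hh (fun r ↦ hasDerivAt_of_contDiffOn hh) B a hx, hB, radMul_apply]
    simp

/-- The radial operator `x·∇`. -/
def eulerOp : puncturedTest →ₗ[ℂ] puncturedTest := lieOp (ContinuousLinearMap.id ℝ Space)

/-- Leibniz rule: x·∇ sends h(|x|) to r h'(r), and this function is `k`. -/
lemma eulerOp_radMul {h k : ℝ → ℝ} (hh : ContDiffOn ℝ ∞ h (Set.Ioi 0))
    (hk : ContDiffOn ℝ ∞ k (Set.Ioi 0)) (hd : ∀ r, 0 < r → HasDerivAt h (k r / r) r)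
    (a : puncturedTest) :
    eulerOp (radMul h hh a) = radMul h hh (eulerOp a) + radMul k hk a := by
  ext x
  rcases eq_or_ne x 0 with rfl | hx
  · rw [puncturedTest_apply_zero, puncturedTest_apply_zero]
  · rw [eulerOp, lieOp_radMul_apply hh hd _ a hx]
    change _ = (radMul h hh _ : Space → ℂ) x + (radMul k hk a : Space → ℂ) x
    have hn : ‖x‖ ≠ 0 := norm_ne_zero_iff.2 hx
    have : k ‖x‖ / ‖x‖ * (‖x‖⁻¹ * inner ℝ x (ContinuousLinearMap.id ℝ Space x)) = k ‖x‖ := by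
      rw [ContinuousLinearMap.id_apply, real_inner_self_eq_norm_sq]; field_simp
    rw [this, radMul_apply, radMul_apply]

lemma divergence_id : divergence (ContinuousLinearMap.id ℝ Space) = 3 := by
  simp [divergence]

/-- Integration by parts for the radial derivative, with a radial weight `h`. -/
lemma inner_eulerOp_radMul {h k : ℝ → ℝ} (hh : ContDiffOn ℝ ∞ h (Set.Ioi 0))
    (hk : ContDiffOn ℝ ∞ k (Set.Ioi 0))
    (hd : ∀ r, 0 < r → HasDerivAt h ((-3 * h r - k r) / r) r) (a b : puncturedTest) :
    inner ℂ (puncturedIncl (eulerOp a)) (puncturedIncl (radMul h hh b)) +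
      inner ℂ (puncturedIncl a) (puncturedIncl (radMul h hh (eulerOp b))) =
        inner ℂ (puncturedIncl a) (puncturedIncl (radMul k hk b)) := by
  -- This function is r h' on (0, ∞), so k = -3h - r h', where 3 is the divergence of x.
  have hm : ContDiffOn ℝ ∞ (fun r ↦ -3 * h r - k r) (Set.Ioi 0) :=
    (contDiffOn_const.mul hh).sub hk
  have h1 := inner_lieOp_add (ContinuousLinearMap.id ℝ Space) a (radMul h hh b)
  rw [divergence_id] at h1
  have h2 := eulerOp_radMul hh hm hd b
  have h3 : radMul _ hm b = (-3 : ℂ) • radMul h hh b - radMul k hk b := by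
    ext x
    change (radMul _ hm b : Space → ℂ) x =
      (-3 : ℂ) * (radMul h hh b : Space → ℂ) x - (radMul k hk b : Space → ℂ) x
    simp only [radMul_apply]; push_cast; ring
  change inner ℂ (puncturedIncl (eulerOp a)) _ + inner ℂ _ (puncturedIncl (eulerOp _)) = _ at h1
  rw [h2, h3, map_add, map_sub, map_smul, inner_add_right, inner_sub_right,
    inner_smul_right] at h1
  push_cast at h1
  linear_combination h1

end RadialMultiplier

/-! ### Wirtinger's inequality. -/

section Wirtinger

/-- Wirtinger's inequality for functions of mean zero on a circle. -/
lemma integral_norm_sq_le_of_hasDerivAt {F F' : ℝ → ℂ} (hF : ∀ t, HasDerivAt F (F' t) t)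
    (hF' : Continuous F') (hper : F (2 * Real.pi) = F 0)
    (hmean : ∫ t in (0 : ℝ)..2 * Real.pi, F t = 0) :
    ∫ t in (0 : ℝ)..2 * Real.pi, ‖F t‖ ^ 2 ≤ ∫ t in (0 : ℝ)..2 * Real.pi, ‖F' t‖ ^ 2 := by
  have hpi : (0 : ℝ) < 2 * Real.pi := Real.two_pi_pos
  have hcont : Continuous F := continuous_iff_continuousAt.2 fun t ↦ (hF t).continuousAt
  have hL2 {G : ℝ → ℂ} (hG : Continuous G) :
      MemLp G 2 (volume.restrict (Set.Ioc 0 (2 * Real.pi))) := by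
    obtain ⟨C, hC⟩ := (isCompact_Icc (a := (0 : ℝ)) (b := 2 * Real.pi)).exists_bound_of_continuousOn
      hG.continuousOn
    refine MemLp.of_bound hG.aestronglyMeasurable C ?_
    filter_upwards [ae_restrict_mem measurableSet_Ioc] with t ht
    exact hC t (Set.Ioc_subset_Icc_self ht)
  have h1 := hasSum_sq_fourierCoeffOn hpi (hL2 hcont)
  have h2 := hasSum_sq_fourierCoeffOn hpi (hL2 hF')
  have hle (n : ℤ) : ‖fourierCoeffOn hpi F n‖ ^ 2 ≤ ‖fourierCoeffOn hpi F' n‖ ^ 2 := by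
    rcases eq_or_ne n 0 with rfl | hn
    · have : fourierCoeffOn hpi F 0 = 0 := by
        rw [fourierCoeffOn_eq_integral]
        simp [hmean]
      rw [this]; simp
    -- By periodicity the boundary term drops and the coefficient of F is that of F' divided by in,
    -- with |n| ≥ 1.
    · rw [fourierCoeffOn_of_hasDerivAt hpi hn (fun t _ ↦ hF t) (hF'.intervalIntegrable _ _), hper]
      have hn' : (1 : ℝ) ≤ |(n : ℝ)| := by exact_mod_cast Int.one_le_abs hn
      gcongr
      rw [sub_self, mul_zero, zero_sub, Complex.ofReal_zero, sub_zero, norm_mul, norm_neg,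
        norm_mul, norm_div, norm_mul, norm_mul, norm_mul, norm_neg]
      simp only [norm_one, Complex.norm_I, Complex.norm_real, Complex.norm_ofNat,
        Complex.norm_intCast, mul_one, Real.norm_eq_abs, abs_of_pos Real.pi_pos,
        Complex.ofReal_mul, Complex.ofReal_ofNat, norm_mul]
      rw [← mul_assoc]
      refine mul_le_of_le_one_left (norm_nonneg _) ?_
      rw [one_div, inv_mul_le_iff₀ (by positivity)]
      nlinarith [Real.pi_pos]
  have h3 := hasSum_le hle h1 h2
  rw [smul_eq_mul, smul_eq_mul] at h3
  exact le_of_mul_le_mul_left h3 (inv_pos.2 (by simpa using hpi))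

end Wirtinger

/-! ### Algebraic lower bounds for the spin-orbit operator σ·L. -/

section SpinOrbit

/-- Angular momentum operators `L_z`, `L_+ = L_x + i L_y`, `L_- = L_x - i L_y` on a space `W` that
is mapped to a Hilbert space by `j`. -/
structure IsAngularMomentum {W H : Type*} [AddCommGroup W] [Module ℂ W] [NormedAddCommGroup H]
    [InnerProductSpace ℂ H] (j : W →ₗ[ℂ] H) (Z P M : W →ₗ[ℂ] W) : Prop where
  symm_z : ∀ a b, inner ℂ (j (Z a)) (j b) = inner ℂ (j a) (j (Z b))
  adjoint : ∀ a b, inner ℂ (j (P a)) (j b) = inner ℂ (j a) (j (M b))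
  comm_zm : ∀ a, Z (M a) - M (Z a) = -M a
  comm_pm : ∀ a, P (M a) - M (P a) = (2 : ℂ) • Z a

variable {W H : Type*} [AddCommGroup W] [Module ℂ W] [NormedAddCommGroup H]
  [InnerProductSpace ℂ H] {j : W →ₗ[ℂ] H} {Z P M : W →ₗ[ℂ] W}

namespace IsAngularMomentum

lemma adjoint' (h : IsAngularMomentum j Z P M) (a b : W) :
    inner ℂ (j (M a)) (j b) = inner ℂ (j a) (j (P b)) := by
  rw [← inner_conj_symm, ← h.adjoint, inner_conj_symm]

lemma inner_comm_zm (h : IsAngularMomentum j Z P M) (a b : W) :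
    inner ℂ (j (Z a)) (j (M b)) - inner ℂ (j (P a)) (j (Z b)) = -inner ℂ (j a) (j (M b)) := by
  rw [h.symm_z, h.adjoint, ← inner_sub_right, ← map_sub, h.comm_zm, map_neg, inner_neg_right]

lemma inner_comm_zm' (h : IsAngularMomentum j Z P M) (a b : W) :
    inner ℂ (j (M b)) (j (Z a)) - inner ℂ (j (Z b)) (j (P a)) = -inner ℂ (j (M b)) (j a) := by
  have := congrArg (starRingEnd ℂ) (h.inner_comm_zm a b)
  simpa only [map_sub, map_neg, inner_conj_symm] using this

lemma inner_comm_pm (h : IsAngularMomentum j Z P M) (a : W) :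
    inner ℂ (j (M a)) (j (M a)) - inner ℂ (j (P a)) (j (P a)) =
      2 * inner ℂ (j a) (j (Z a)) := by
  rw [h.adjoint', h.adjoint, ← inner_sub_right, ← map_sub, h.comm_pm, map_smul, inner_smul_right]

end IsAngularMomentum

/-- The form `⟨Λf, Λf⟩ + s ⟨f, Λf⟩` of the spin-orbit operator `Λ = σ·L`, at `f = (a, b)`. -/
def spinOrbitForm (j : W →ₗ[ℂ] H) (Z P M : W →ₗ[ℂ] W) (s : ℂ) (a b : W) : ℂ :=
  inner ℂ (j (Z a + M b)) (j (Z a + M b)) + inner ℂ (j (P a - Z b)) (j (P a - Z b)) +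
    s * (inner ℂ (j a) (j (Z a + M b)) + inner ℂ (j b) (j (P a - Z b)))

lemma re_inner_self_nonneg' (v : H) : 0 ≤ (inner ℂ v v).re := inner_self_nonneg (𝕜 := ℂ)

namespace IsAngularMomentum

/-- `Λ² + Λ = L² ≥ 0`. -/
lemma spinOrbitForm_one_nonneg (h : IsAngularMomentum j Z P M) (a b : W) :
    0 ≤ (spinOrbitForm j Z P M 1 a b).re := by
  -- This is 2L² = 2L_z² + L_+L_- + L_-L_+ in quadratic form, on each component.
  have key : 2 * spinOrbitForm j Z P M 1 a b =
      2 * inner ℂ (j (Z a)) (j (Z a)) + 2 * inner ℂ (j (Z b)) (j (Z b)) +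
        inner ℂ (j (P a)) (j (P a)) + inner ℂ (j (M a)) (j (M a)) +
        inner ℂ (j (P b)) (j (P b)) + inner ℂ (j (M b)) (j (M b)) := by
    simp only [spinOrbitForm, map_add, map_sub, inner_add_left, inner_add_right, inner_sub_left,
      inner_sub_right]
    linear_combination 2 * h.inner_comm_zm a b + 2 * h.inner_comm_zm' a b -
      h.inner_comm_pm a + h.inner_comm_pm b - 2 * h.adjoint' b a
  have h2 := congrArg Complex.re key
  simp only [Complex.add_re, Complex.mul_re, Complex.re_ofNat, Complex.im_ofNat, zero_mul,
    sub_zero] at h2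
  have := re_inner_self_nonneg' (j (Z a))
  have := re_inner_self_nonneg' (j (Z b))
  have := re_inner_self_nonneg' (j (P a))
  have := re_inner_self_nonneg' (j (M a))
  have := re_inner_self_nonneg' (j (P b))
  have := re_inner_self_nonneg' (j (M b))
  linarith

/-- Arranged for `a` of odd and `b` of even L_z: there Z on `a` and Z - 1 on `b` have odd integer
spectrum, so both differences are nonnegative. -/
lemma spinOrbitForm_two_eq (h : IsAngularMomentum j Z P M) (a b : W) :
    spinOrbitForm j Z P M 2 a b =
      inner ℂ (j (M a)) (j (M a)) + inner ℂ (j (M b + a)) (j (M b + a)) +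
        (inner ℂ (j (Z a)) (j (Z a)) - inner ℂ (j a) (j a)) +
        (inner ℂ (j (Z b - b)) (j (Z b - b)) - inner ℂ (j b) (j b)) := by
  simp only [spinOrbitForm, map_add, map_sub, inner_add_left, inner_add_right, inner_sub_left,
    inner_sub_right]
  linear_combination h.inner_comm_zm a b + h.inner_comm_zm' a b -
    h.inner_comm_pm a - 2 * h.adjoint' b a + h.symm_z b b

/-- The counterpart of `spinOrbitForm_two_eq` for the opposite parities, with Z + 1 on `a` and Z on
`b`. -/
lemma spinOrbitForm_two_eq' (h : IsAngularMomentum j Z P M) (a b : W) :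
    spinOrbitForm j Z P M 2 a b =
      inner ℂ (j (P a + b)) (j (P a + b)) + inner ℂ (j (P b)) (j (P b)) +
        (inner ℂ (j (Z a + a)) (j (Z a + a)) - inner ℂ (j a) (j a)) +
        (inner ℂ (j (Z b)) (j (Z b)) - inner ℂ (j b) (j b)) := by
  simp only [spinOrbitForm, map_add, map_sub, inner_add_left, inner_add_right, inner_sub_left,
    inner_sub_right]
  linear_combination h.inner_comm_zm a b + h.inner_comm_zm' a b +
    h.inner_comm_pm b - h.adjoint' b a - h.adjoint a b - h.symm_z a a

/-- `Λ² + 2Λ ≥ 0`. The operator `T` stands for the rotation by `π` about the `z`-axis; the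
hypotheses `h1`, `h2`, `h3` say that the spectrum of `L_z` on its eigenspaces consists of integers
of the appropriate parity. -/
lemma spinOrbitForm_two_nonneg (h : IsAngularMomentum j Z P M) {T : W →ₗ[ℂ] W}
    (hT : ∀ a, T (T a) = a) (hTj : ∀ a b, inner ℂ (j (T a)) (j (T b)) = inner ℂ (j a) (j b))
    (hTZ : ∀ a, T (Z a) = Z (T a)) (hTP : ∀ a, T (P a) = -P (T a))
    (hTM : ∀ a, T (M a) = -M (T a))
    (h1 : ∀ a, T a = -a → (inner ℂ (j a) (j a)).re ≤ (inner ℂ (j (Z a)) (j (Z a))).re)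
    (h2 : ∀ a, T a = a → (inner ℂ (j a) (j a)).re ≤ (inner ℂ (j (Z a - a)) (j (Z a - a))).re)
    (h3 : ∀ a, T a = a → (inner ℂ (j a) (j a)).re ≤ (inner ℂ (j (Z a + a)) (j (Z a + a))).re)
    (a b : W) : 0 ≤ (spinOrbitForm j Z P M 2 a b).re := by
  have hodd (a b : W) (ha : T a = -a) (hb : T b = b) :
      0 ≤ (spinOrbitForm j Z P M 2 a b).re := by
    rw [h.spinOrbitForm_two_eq]
    simp only [Complex.add_re, Complex.sub_re]
    linarith [re_inner_self_nonneg' (j (M a)), re_inner_self_nonneg' (j (M b + a)), h1 a ha,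
      h2 b hb]
  have heven (a b : W) (ha : T a = a) (hb : T b = -b) :
      0 ≤ (spinOrbitForm j Z P M 2 a b).re := by
    rw [h.spinOrbitForm_two_eq']
    simp only [Complex.add_re, Complex.sub_re]
    linarith [re_inner_self_nonneg' (j (P b)), re_inner_self_nonneg' (j (P a + b)), h1 b hb,
      h3 a ha]
  have orth (u v : W) (hu : T u = u) (hv : T v = -v) :
      inner ℂ (j u) (j v) = 0 ∧ inner ℂ (j v) (j u) = 0 := by
    have e1 := hTj u v
    have e2 := hTj v u
    rw [hu, hv, map_neg, inner_neg_right] at e1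
    rw [hu, hv, map_neg, inner_neg_left] at e2
    exact ⟨by linear_combination -e1 / 2, by linear_combination -e2 / 2⟩
  -- L_± change L_z by one, so Λ preserves each of the two sectors (odd, even) and (even, odd). The
  -- sectors are orthogonal, and the form splits.
  have main (a b a' b' : W) (ha : T a = -a) (hb : T b = b) (ha' : T a' = a') (hb' : T b' = -b') :
      0 ≤ (spinOrbitForm j Z P M 2 (a + a') (b + b')).re := by
    have k1 := orth (Z a' + M b') (Z a + M b) (by rw [map_add, hTZ, hTM, ha', hb']; simp)
      (by rw [map_add, hTZ, hTM, ha, hb]; simp; abel)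
    have k2 := orth (P a - Z b) (P a' - Z b') (by rw [map_sub, hTZ, hTP, ha, hb]; simp)
      (by rw [map_sub, hTZ, hTP, ha', hb']; simp; abel)
    have k3 := orth (Z a' + M b') a (by rw [map_add, hTZ, hTM, ha', hb']; simp) ha
    have k4 := orth a' (Z a + M b) ha' (by rw [map_add, hTZ, hTM, ha, hb]; simp; abel)
    have k5 := orth b (P a' - Z b') hb (by rw [map_sub, hTZ, hTP, ha', hb']; simp; abel)
    have k6 := orth (P a - Z b) b' (by rw [map_sub, hTZ, hTP, ha, hb]; simp) hb'
    have e1 : Z (a + a') + M (b + b') = (Z a + M b) + (Z a' + M b') := by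
      simp only [map_add]; abel
    have e2 : P (a + a') - Z (b + b') = (P a - Z b) + (P a' - Z b') := by
      simp only [map_add]; abel
    have key : spinOrbitForm j Z P M 2 (a + a') (b + b') =
        spinOrbitForm j Z P M 2 a b + spinOrbitForm j Z P M 2 a' b' := by
      rw [spinOrbitForm, spinOrbitForm, spinOrbitForm, e1, e2]
      generalize Z a + M b = u at *
      generalize Z a' + M b' = u' at *
      generalize P a - Z b = v at *
      generalize P a' - Z b' = v' at *
      simp only [map_add, inner_add_left, inner_add_right]
      linear_combination k1.1 + k1.2 + k2.1 + k2.2 + 2 * k3.2 + 2 * k4.1 + 2 * k5.1 + 2 * k6.2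
    rw [key, Complex.add_re]
    exact add_nonneg (hodd a b ha hb) (heven a' b' ha' hb')
  have hhalf (a : W) : (2⁻¹ : ℂ) • a + (2⁻¹ : ℂ) • a = a := by
    rw [← add_smul]; norm_num
  have ha : a = (2⁻¹ : ℂ) • (a - T a) + (2⁻¹ : ℂ) • (a + T a) := by
    rw [← smul_add, ← hhalf a, smul_add]; simp; module
  have hb : b = (2⁻¹ : ℂ) • (b + T b) + (2⁻¹ : ℂ) • (b - T b) := by
    rw [← smul_add, ← hhalf b, smul_add]; simp; module
  rw [ha, hb]
  refine main _ _ _ _ ?_ ?_ ?_ ?_ <;> simp only [map_smul, map_add, map_sub, hT] <;> module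

end IsAngularMomentum

end SpinOrbit

/-! ### Angular momentum operators and rotations about the third axis. -/

section Rotations

/-- The vector field `e₁ × x`. -/
def crossX : Space →L[ℝ] Space := Matrix.toEuclideanCLM (𝕜 := ℝ) !![0, 0, 0; 0, 0, -1; 0, 1, 0]

/-- The vector field `e₂ × x`. -/
def crossY : Space →L[ℝ] Space := Matrix.toEuclideanCLM (𝕜 := ℝ) !![0, 0, 1; 0, 0, 0; -1, 0, 0]

/-- The vector field `e₃ × x`. -/
def crossZ : Space →L[ℝ] Space := Matrix.toEuclideanCLM (𝕜 := ℝ) !![0, -1, 0; 1, 0, 0; 0, 0, 0]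

lemma crossX_apply (x : Space) : crossX x = !₂[0, -x 2, x 1] := by
  ext i; fin_cases i <;> simp [crossX, Matrix.mulVec, dotProduct, Fin.sum_univ_three]

lemma crossY_apply (x : Space) : crossY x = !₂[x 2, 0, -x 0] := by
  ext i; fin_cases i <;> simp [crossY, Matrix.mulVec, dotProduct, Fin.sum_univ_three]

lemma crossZ_apply (x : Space) : crossZ x = !₂[-x 1, x 0, 0] := by
  ext i; fin_cases i <;> simp [crossZ, Matrix.mulVec, dotProduct, Fin.sum_univ_three]

lemma inner_space (x y : Space) : inner ℝ x y = x 0 * y 0 + x 1 * y 1 + x 2 * y 2 := by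
  simp [PiLp.inner_apply, Fin.sum_univ_three, mul_comm]

lemma inner_crossX (x : Space) : inner ℝ x (crossX x) = 0 := by
  rw [crossX_apply, inner_space]; simp; ring

lemma inner_crossY (x : Space) : inner ℝ x (crossY x) = 0 := by
  rw [crossY_apply, inner_space]; simp; ring

lemma inner_crossZ (x : Space) : inner ℝ x (crossZ x) = 0 := by
  rw [crossZ_apply, inner_space]; simp; ring

lemma divergence_eq_zero {B : Space →L[ℝ] Space} (hB : ∀ x, inner ℝ x (B x) = 0) :
    divergence B = 0 := by
  refine Finset.sum_eq_zero fun k _ ↦ ?_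
  simpa [EuclideanSpace.inner_single_left] using hB (EuclideanSpace.single k 1)

lemma inner_lieOp {B : Space →L[ℝ] Space} (hB : ∀ x, inner ℝ x (B x) = 0) (a b : puncturedTest) :
    inner ℂ (puncturedIncl (lieOp B a)) (puncturedIncl b) =
      -inner ℂ (puncturedIncl a) (puncturedIncl (lieOp B b)) := by
  have := inner_lieOp_add B a b
  rw [divergence_eq_zero hB] at this
  simp only [Complex.ofReal_zero, neg_zero, zero_mul] at this
  linear_combination this

lemma lieOp_neg (B : Space →L[ℝ] Space) (a : puncturedTest) : lieOp (-B) a = -lieOp B a := by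
  ext x
  change fderiv ℝ (a : Space → ℂ) x (-B x) = -fderiv ℝ (a : Space → ℂ) x (B x)
  rw [map_neg]

lemma lieOp_comm_xy (a : puncturedTest) :
    lieOp crossX (lieOp crossY a) - lieOp crossY (lieOp crossX a) = -lieOp crossZ a := by
  rw [lieOp_commutator, ← lieOp_neg]
  refine congrArg (fun B ↦ lieOp B a) ?_
  ext x i
  fin_cases i <;> simp [crossX_apply, crossY_apply, crossZ_apply]

lemma lieOp_comm_zx (a : puncturedTest) :
    lieOp crossZ (lieOp crossX a) - lieOp crossX (lieOp crossZ a) = -lieOp crossY a := by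
  rw [lieOp_commutator, ← lieOp_neg]
  refine congrArg (fun B ↦ lieOp B a) ?_
  ext x i
  fin_cases i <;> simp [crossX_apply, crossY_apply, crossZ_apply]

lemma lieOp_comm_zy (a : puncturedTest) :
    lieOp crossZ (lieOp crossY a) - lieOp crossY (lieOp crossZ a) = lieOp crossX a := by
  rw [lieOp_commutator]
  refine congrArg (fun B ↦ lieOp B a) ?_
  ext x i
  fin_cases i <;> simp [crossX_apply, crossY_apply, crossZ_apply]

/-- The angular momentum operator `L_z`. -/
def angZ : puncturedTest →ₗ[ℂ] puncturedTest := -Complex.I • lieOp crossZ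

/-- The angular momentum operator `L_+ = L_x + i L_y`. -/
def angP : puncturedTest →ₗ[ℂ] puncturedTest := -Complex.I • lieOp crossX + lieOp crossY

/-- The angular momentum operator `L_- = L_x - i L_y`. -/
def angM : puncturedTest →ₗ[ℂ] puncturedTest := -Complex.I • lieOp crossX - lieOp crossY

lemma angZ_apply (a : puncturedTest) : angZ a = -Complex.I • lieOp crossZ a := rfl

lemma angP_apply (a : puncturedTest) : angP a = -Complex.I • lieOp crossX a + lieOp crossY a := rfl

lemma angM_apply (a : puncturedTest) : angM a = -Complex.I • lieOp crossX a - lieOp crossY a := rfl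

lemma isAngularMomentum : IsAngularMomentum puncturedIncl angZ angP angM where
  symm_z a b := by
    simp only [angZ_apply, map_smul, inner_smul_left, inner_smul_right, inner_lieOp inner_crossZ,
      map_neg, Complex.conj_I]
    ring
  adjoint a b := by
    simp only [angP_apply, angM_apply, map_add, map_sub, map_smul, inner_add_left, inner_sub_right,
      inner_smul_left, inner_smul_right, inner_lieOp inner_crossX, inner_lieOp inner_crossY,
      map_neg, Complex.conj_I]
    ring
  comm_zm a := by
    have h1 := lieOp_comm_zx a
    have h2 := lieOp_comm_zy a
    rw [sub_eq_iff_eq_add] at h1 h2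
    simp only [angZ_apply, angM_apply, map_sub, map_smul, h1, h2]
    match_scalars <;> first | ring1 | linear_combination -Complex.I_sq
  comm_pm a := by
    have h1 := lieOp_comm_xy a
    rw [sub_eq_iff_eq_add] at h1
    simp only [angZ_apply, angM_apply, angP_apply, map_sub, map_add, map_smul, h1]
    module

/-- The rotation by the angle `t` about the third axis. -/
def rotZ (t : ℝ) : Space →ₗᵢ[ℝ] Space where
  toFun x := !₂[Real.cos t * x 0 - Real.sin t * x 1, Real.sin t * x 0 + Real.cos t * x 1, x 2]
  map_add' x y := by ext i; fin_cases i <;> simp <;> ring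
  map_smul' r x := by ext i; fin_cases i <;> simp <;> ring
  norm_map' x := by
    rw [← sq_eq_sq₀ (norm_nonneg _) (norm_nonneg _), EuclideanSpace.norm_sq_eq,
      EuclideanSpace.norm_sq_eq]
    simp [Fin.sum_univ_three]
    linear_combination (x 0 ^ 2 + x 1 ^ 2) * Real.sin_sq_add_cos_sq t

lemma rotZ_apply (t : ℝ) (x : Space) : rotZ t x =
    !₂[Real.cos t * x 0 - Real.sin t * x 1, Real.sin t * x 0 + Real.cos t * x 1, x 2] := rfl

lemma rotZ_add (s t : ℝ) (x : Space) : rotZ (s + t) x = rotZ s (rotZ t x) := by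
  ext i; fin_cases i <;> simp [rotZ_apply, Real.cos_add, Real.sin_add] <;> ring

lemma rotZ_pi_rotZ_pi (x : Space) : rotZ Real.pi (rotZ Real.pi x) = x := by
  ext i; fin_cases i <;> simp [rotZ_apply]

lemma continuous_rotZ : Continuous fun p : ℝ × Space ↦ rotZ p.1 p.2 := by
  simp only [rotZ_apply]
  refine (PiLp.continuous_toLp 2 _).comp (continuous_pi fun i ↦ ?_)
  fin_cases i <;> simp <;> fun_prop

lemma hasDerivAt_rotZ (x : Space) (t : ℝ) :
    HasDerivAt (fun t ↦ rotZ t x) (crossZ (rotZ t x)) t := by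
  have hc := Real.hasDerivAt_cos t
  have hs := Real.hasDerivAt_sin t
  have h : HasDerivAt (fun t ↦ ![Real.cos t * x 0 - Real.sin t * x 1,
      Real.sin t * x 0 + Real.cos t * x 1, x 2]) ![-(rotZ t x) 1, rotZ t x 0, 0] t := by
    rw [hasDerivAt_pi]
    intro i
    fin_cases i
    · refine ((hc.mul_const (x 0)).sub (hs.mul_const (x 1))).congr_deriv ?_
      simp [rotZ_apply]; ring
    · refine ((hs.mul_const (x 0)).add (hc.mul_const (x 1))).congr_deriv ?_
      simp [rotZ_apply]; ring
    · simpa using hasDerivAt_const t (x 2)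
  rw [crossZ_apply]
  exact (PiLp.hasFDerivAt_toLp 2 _).comp_hasDerivAt t h

/-- The rotation about the third axis, as an equivalence. -/
def rotZEquiv (t : ℝ) : Space ≃ₗᵢ[ℝ] Space := (rotZ t).toLinearIsometryEquiv rfl

lemma integral_comp_rotZ (t : ℝ) {F : Type*} [NormedAddCommGroup F] [NormedSpace ℝ F]
    (g : Space → F) : ∫ x, g (rotZ t x) = ∫ x, g x :=
  (rotZEquiv t).measurePreserving.integral_comp
    (rotZEquiv t).toHomeomorph.measurableEmbedding g

lemma comp_rotZ_mem (t : ℝ) {a : Space → ℂ} (ha : a ∈ puncturedTest) :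
    (fun x ↦ a (rotZ t x)) ∈ puncturedTest := by
  refine ⟨ha.1.comp (rotZ t).contDiff, ha.2.1.comp_homeomorph (rotZEquiv t).toHomeomorph, ?_⟩
  have h : Tendsto (rotZ t) (𝓝 0) (𝓝 0) := by
    simpa using (rotZ t).continuous.tendsto 0
  exact h.eventually ha.2.2

/-- Composition with the rotation by `π` about the third axis. -/
def halfTurn : puncturedTest →ₗ[ℂ] puncturedTest where
  toFun a := ⟨_, comp_rotZ_mem Real.pi a.2⟩
  map_add' _ _ := rfl
  map_smul' _ _ := rfl

lemma halfTurn_apply (a : puncturedTest) (x : Space) :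
    (halfTurn a : Space → ℂ) x = (a : Space → ℂ) (rotZ Real.pi x) := rfl

lemma halfTurn_halfTurn (a : puncturedTest) : halfTurn (halfTurn a) = a := by
  ext x; rw [halfTurn_apply, halfTurn_apply, rotZ_pi_rotZ_pi]

lemma inner_halfTurn (a b : puncturedTest) :
    inner ℂ (puncturedIncl (halfTurn a)) (puncturedIncl (halfTurn b)) =
      inner ℂ (puncturedIncl a) (puncturedIncl b) := by
  simp only [inner_puncturedIncl, halfTurn_apply]
  exact integral_comp_rotZ Real.pi
    fun x ↦ inner ℂ ((a : Space → ℂ) x) ((b : Space → ℂ) x)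

lemma halfTurn_lieOp {B C : Space →L[ℝ] Space}
    (h : ∀ x, C (rotZ Real.pi x) = rotZ Real.pi (B x)) (a : puncturedTest) :
    halfTurn (lieOp C a) = lieOp B (halfTurn a) := by
  ext x
  have h1 : HasFDerivAt (halfTurn a : Space → ℂ)
      (fderiv ℝ (a : Space → ℂ) (rotZ Real.pi x) ∘L (rotZ Real.pi).toContinuousLinearMap) x :=
    (differentiableAt_of_mem a.2 _).hasFDerivAt.comp x
      (rotZ Real.pi).toContinuousLinearMap.hasFDerivAt
  rw [halfTurn_apply, lieOp_apply, lieOp_apply, h1.fderiv, h]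
  rfl

lemma halfTurn_crossZ (a : puncturedTest) :
    halfTurn (lieOp crossZ a) = lieOp crossZ (halfTurn a) :=
  halfTurn_lieOp (fun x ↦ by
    ext i; fin_cases i <;> simp [rotZ_apply, crossZ_apply]) a

lemma halfTurn_crossX (a : puncturedTest) :
    halfTurn (lieOp crossX a) = -lieOp crossX (halfTurn a) := by
  rw [← lieOp_neg]
  exact halfTurn_lieOp (fun x ↦ by
    ext i; fin_cases i <;> simp [rotZ_apply, crossX_apply]) a

lemma halfTurn_crossY (a : puncturedTest) :
    halfTurn (lieOp crossY a) = -lieOp crossY (halfTurn a) := by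
  rw [← lieOp_neg]
  exact halfTurn_lieOp (fun x ↦ by
    ext i; fin_cases i <;> simp [rotZ_apply, crossY_apply]) a

lemma integrable_prod_comp_rotZ {g : Space → ℝ} (hg : Continuous g) (hc : HasCompactSupport g)
    (r : ℝ) : Integrable (fun p : ℝ × Space ↦ g (rotZ p.1 p.2))
      ((volume.restrict (Set.Ioc 0 r)).prod volume) := by
  have hm : AEStronglyMeasurable (fun p : ℝ × Space ↦ g (rotZ p.1 p.2))
      ((volume.restrict (Set.Ioc 0 r)).prod volume) :=
    (hg.comp continuous_rotZ).aestronglyMeasurable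
  rw [integrable_prod_iff hm]
  have hi := hg.integrable_of_hasCompactSupport hc (μ := volume)
  refine ⟨Eventually.of_forall fun t ↦
    ((rotZEquiv t).measurePreserving.integrable_comp_emb
      (rotZEquiv t).toHomeomorph.measurableEmbedding).2 hi, ?_⟩
  simp only [integral_comp_rotZ _ fun x ↦ ‖g x‖]
  exact integrable_const _

/-- By Fubini and rotation invariance, averaging over the circles does not change an integral over
space. -/
lemma integral_le_of_circle_le {g k : Space → ℝ} (hg : Continuous g) (hgc : HasCompactSupport g)
    (hk : Continuous k) (hkc : HasCompactSupport k)
    (h : ∀ x, ∫ t in (0 : ℝ)..2 * Real.pi, g (rotZ t x) ≤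
      ∫ t in (0 : ℝ)..2 * Real.pi, k (rotZ t x)) :
    ∫ x, g x ≤ ∫ x, k x := by
  have hpi : (0 : ℝ) < 2 * Real.pi := Real.two_pi_pos
  have key {g : Space → ℝ} (hg : Continuous g) (hgc : HasCompactSupport g) :
      ∫ x, ∫ t in (0 : ℝ)..2 * Real.pi, g (rotZ t x) = 2 * Real.pi * ∫ x, g x := by
    simp only [intervalIntegral.integral_of_le hpi.le]
    rw [← integral_integral_swap (f := fun t x ↦ g (rotZ t x))
      (integrable_prod_comp_rotZ hg hgc _)]
    simp only [integral_comp_rotZ _ g]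
    simp [hpi.le]
  have hint {g : Space → ℝ} (hg : Continuous g) (hgc : HasCompactSupport g) :
      Integrable fun x ↦ ∫ t in (0 : ℝ)..2 * Real.pi, g (rotZ t x) := by
    simp only [intervalIntegral.integral_of_le hpi.le]
    exact (integrable_prod_comp_rotZ hg hgc (2 * Real.pi)).integral_prod_right
  have := integral_mono (hint hg hgc) (hint hk hkc) h
  rw [key hg hgc, key hk hkc] at this
  exact le_of_mul_le_mul_left this hpi

lemma re_inner_self_puncturedIncl (a : puncturedTest) :
    (inner ℂ (puncturedIncl a) (puncturedIncl a)).re = ∫ x, ‖(a : Space → ℂ) x‖ ^ 2 := by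
  rw [inner_puncturedIncl, ← RCLike.re_to_complex,
    ← integral_re (integrable_inner_puncturedTest a a)]
  refine integral_congr_ae (Eventually.of_forall fun x ↦ ?_)
  exact (norm_sq_eq_re_inner (𝕜 := ℂ) _).symm

/-- If `e^{inπ} a ∘ R_π = -a` then `L_z + n` is bounded below by one at `a`. -/
lemma le_norm_angZ_add (n : ℤ) {a : puncturedTest}
    (ha : ∀ x, Complex.exp (Complex.I * n * Real.pi) * (a : Space → ℂ) (rotZ Real.pi x) =
      -(a : Space → ℂ) x) :
    (inner ℂ (puncturedIncl a) (puncturedIncl a)).re ≤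
      (inner ℂ (puncturedIncl (angZ a + (n : ℂ) • a)) (puncturedIncl (angZ a + (n : ℂ) • a))).re := by
  rw [re_inner_self_puncturedIncl, re_inner_self_puncturedIncl]
  set c := angZ a + (n : ℂ) • a
  have hsq (b : puncturedTest) : Continuous (fun x ↦ ‖(b : Space → ℂ) x‖ ^ 2) ∧
      HasCompactSupport (fun x ↦ ‖(b : Space → ℂ) x‖ ^ 2) :=
    ⟨b.2.1.continuous.norm.pow 2, b.2.2.1.comp_left (g := fun z : ℂ ↦ ‖z‖ ^ 2) (by simp)⟩
  refine integral_le_of_circle_le (hsq a).1 (hsq a).2 (hsq c).1 (hsq c).2 fun x ↦ ?_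
  have hrot : Continuous fun t ↦ rotZ t x :=
    continuous_iff_continuousAt.2 fun t ↦ (hasDerivAt_rotZ x t).continuousAt
  let e (t : ℝ) : ℂ := Complex.exp (Complex.I * n * t)
  have he (t : ℝ) : HasDerivAt e (Complex.I * n * e t) t := by
    have h1 : HasDerivAt (fun t : ℝ ↦ Complex.I * n * (t : ℂ)) (Complex.I * n) t := by
      simpa using (Complex.ofRealCLM.hasDerivAt (x := t)).const_mul (Complex.I * n)
    exact h1.cexp.congr_deriv (mul_comm _ _)
  have hnorm (t : ℝ) : ‖e t‖ = 1 := by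
    have : Complex.I * n * t = ((n * t : ℝ) : ℂ) * Complex.I := by push_cast; ring
    simp only [e, this, Complex.norm_exp_ofReal_mul_I]
  have hF (t : ℝ) : HasDerivAt (fun t ↦ e t * (a : Space → ℂ) (rotZ t x))
      (Complex.I * (e t * (c : Space → ℂ) (rotZ t x))) t := by
    have h2 := (differentiableAt_of_mem a.2 (rotZ t x)).hasFDerivAt.comp_hasDerivAt t
      (hasDerivAt_rotZ x t)
    refine ((he t).mul h2).congr_deriv ?_
    have hc : (c : Space → ℂ) (rotZ t x) = -Complex.I *
        fderiv ℝ (a : Space → ℂ) (rotZ t x) (crossZ (rotZ t x)) +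
          n * (a : Space → ℂ) (rotZ t x) := rfl
    rw [hc, Function.comp_apply]
    linear_combination (e t * fderiv ℝ (a : Space → ℂ) (rotZ t x) (crossZ (rotZ t x))) *
      Complex.I_sq
  have hecont : Continuous e := continuous_iff_continuousAt.2 fun t ↦ (he t).continuousAt
  have hFcont : Continuous fun t ↦ e t * (a : Space → ℂ) (rotZ t x) :=
    hecont.mul (a.2.1.continuous.comp hrot)
  -- Antiperiodicity under a half turn gives at once the period 2π and the vanishing mean that
  -- Wirtinger's inequality needs.
  have hanti (t : ℝ) : e (t + Real.pi) * (a : Space → ℂ) (rotZ (t + Real.pi) x) =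
      -(e t * (a : Space → ℂ) (rotZ t x)) := by
    have h3 : e (t + Real.pi) = e t * Complex.exp (Complex.I * n * Real.pi) := by
      simp only [e, ← Complex.exp_add]; push_cast; ring_nf
    rw [h3, add_comm t, rotZ_add, mul_assoc, ha, mul_neg]
  have h4 := integral_norm_sq_le_of_hasDerivAt hF ?_ ?_ ?_
  · simpa only [norm_mul, hnorm, Complex.norm_I, one_mul] using h4
  · exact continuous_const.mul (hecont.mul (c.2.1.continuous.comp hrot))
  · have h5 := hanti Real.pi
    have h6 := hanti 0
    rw [zero_add] at h6
    rw [two_mul, h5, h6, neg_neg]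
  · rw [← intervalIntegral.integral_add_adjacent_intervals (hFcont.intervalIntegrable 0 Real.pi)
      (hFcont.intervalIntegrable _ _)]
    have h7 := intervalIntegral.integral_comp_add_right (a := 0) (b := Real.pi)
      (fun t ↦ e t * (a : Space → ℂ) (rotZ t x)) Real.pi
    rw [zero_add, ← two_mul] at h7
    rw [← h7]
    simp only [hanti, intervalIntegral.integral_neg, add_neg_cancel]

/-- `Λ² + 2Λ ≥ 0` for the spin-orbit operator `Λ = σ·L`. -/
lemma spinOrbitForm_two_nonneg (a b : puncturedTest) :
    0 ≤ (spinOrbitForm puncturedIncl angZ angP angM 2 a b).re := by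
  refine isAngularMomentum.spinOrbitForm_two_nonneg halfTurn_halfTurn inner_halfTurn
    (fun a ↦ ?_) (fun a ↦ ?_) (fun a ↦ ?_) (fun a ha ↦ ?_) (fun a ha ↦ ?_) (fun a ha ↦ ?_) a b
  · simp only [angZ_apply, map_smul, halfTurn_crossZ]
  · simp only [angP_apply, map_smul, map_add, halfTurn_crossX, halfTurn_crossY]; module
  · simp only [angM_apply, map_smul, map_sub, halfTurn_crossX, halfTurn_crossY]; module
  -- The sign (-1)ⁿ times the parity of `a` must be -1: n = 0 for odd `a`, and n = -1 or 1 for even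
  -- `a`.
  · have := le_norm_angZ_add 0 (a := a) fun x ↦ by
      rw [← halfTurn_apply, ha]; simp
    simpa using this
  · have := le_norm_angZ_add (-1) (a := a) fun x ↦ by
      rw [← halfTurn_apply, ha]
      have : Complex.I * ((-1 : ℤ) : ℂ) * Real.pi = -(Real.pi * Complex.I) := by push_cast; ring
      rw [this, Complex.exp_neg, Complex.exp_pi_mul_I]; norm_num
    simpa [sub_eq_add_neg] using this
  · have := le_norm_angZ_add 1 (a := a) fun x ↦ by
      rw [← halfTurn_apply, ha]
      have : Complex.I * ((1 : ℤ) : ℂ) * Real.pi = Real.pi * Complex.I := by push_cast; ring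
      rw [this, Complex.exp_pi_mul_I]; norm_num
    simpa using this

end Rotations

/-! ### The critical Coulomb inequality in radial and angular variables. -/

section RadialEstimate

lemma radMul_radMul {h k l : ℝ → ℝ} (hh : ContDiffOn ℝ ∞ h (Set.Ioi 0))
    (hk : ContDiffOn ℝ ∞ k (Set.Ioi 0)) (hl : ContDiffOn ℝ ∞ l (Set.Ioi 0))
    (heq : ∀ r, 0 < r → h r * k r = l r) (a : puncturedTest) :
    radMul h hh (radMul k hk a) = radMul l hl a := by
  ext x
  rcases eq_or_ne x 0 with rfl | hx
  · rw [puncturedTest_apply_zero, puncturedTest_apply_zero]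
  · rw [radMul_apply, radMul_apply, radMul_apply, ← heq _ (norm_pos_iff.2 hx)]
    push_cast; ring

lemma radMul_add {h k l : ℝ → ℝ} (hh : ContDiffOn ℝ ∞ h (Set.Ioi 0))
    (hk : ContDiffOn ℝ ∞ k (Set.Ioi 0)) (hl : ContDiffOn ℝ ∞ l (Set.Ioi 0))
    (heq : ∀ r, 0 < r → h r + k r = l r) (a : puncturedTest) :
    radMul h hh a + radMul k hk a = radMul l hl a := by
  ext x
  rcases eq_or_ne x 0 with rfl | hx
  · rw [puncturedTest_apply_zero, puncturedTest_apply_zero]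
  · change (radMul h hh a : Space → ℂ) x + (radMul k hk a : Space → ℂ) x = _
    rw [radMul_apply, radMul_apply, radMul_apply, ← heq _ (norm_pos_iff.2 hx)]
    push_cast; ring

lemma inner_radMul_left {h : ℝ → ℝ} (hh : ContDiffOn ℝ ∞ h (Set.Ioi 0)) (a b : puncturedTest) :
    inner ℂ (puncturedIncl (radMul h hh a)) (puncturedIncl b) =
      inner ℂ (puncturedIncl a) (puncturedIncl (radMul h hh b)) := by
  have h1 : ContDiffOn ℝ ∞ (fun _ : ℝ ↦ (1 : ℝ)) (Set.Ioi 0) := contDiffOn_const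
  have hone (c : puncturedTest) : radMul _ h1 c = c := by
    ext x; rw [radMul_apply]; simp
  have := inner_radMul hh h1 h1 hh (fun r _ ↦ mul_comm _ _) a b
  rwa [hone, hone] at this

lemma re_inner_radMul_self {h : ℝ → ℝ} (hh : ContDiffOn ℝ ∞ h (Set.Ioi 0)) (a : puncturedTest) :
    (inner ℂ (puncturedIncl a) (puncturedIncl (radMul h hh a))).re =
      ∫ x, h ‖x‖ * ‖(a : Space → ℂ) x‖ ^ 2 := by
  rw [inner_puncturedIncl, ← RCLike.re_to_complex,
    ← integral_re (integrable_inner_puncturedTest _ _)]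
  refine integral_congr_ae (Eventually.of_forall fun x ↦ ?_)
  change RCLike.re (inner ℂ ((a : Space → ℂ) x) (((h ‖x‖ : ℝ) : ℂ) * (a : Space → ℂ) x)) = _
  rw [← smul_eq_mul, inner_smul_right, RCLike.re_to_complex, Complex.re_ofReal_mul]
  congr 1
  exact (norm_sq_eq_re_inner (𝕜 := ℂ) ((a : Space → ℂ) x)).symm

lemma eulerOp_lieOp (B : Space →L[ℝ] Space) (a : puncturedTest) :
    eulerOp (lieOp B a) = lieOp B (eulerOp a) := by
  have h := lieOp_commutator (ContinuousLinearMap.id ℝ Space) B a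
  rw [ContinuousLinearMap.comp_id, ContinuousLinearMap.id_comp, sub_self] at h
  have h0 : lieOp (0 : Space →L[ℝ] Space) a = 0 := by
    ext x; rw [lieOp_apply]; simp
  rw [h0, sub_eq_zero] at h
  exact h

lemma eulerOp_angZ (a : puncturedTest) : eulerOp (angZ a) = angZ (eulerOp a) := by
  simp only [angZ_apply, map_smul, eulerOp_lieOp]

lemma eulerOp_angP (a : puncturedTest) : eulerOp (angP a) = angP (eulerOp a) := by
  simp only [angP_apply, map_smul, map_add, eulerOp_lieOp]

lemma eulerOp_angM (a : puncturedTest) : eulerOp (angM a) = angM (eulerOp a) := by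
  simp only [angM_apply, map_smul, map_sub, eulerOp_lieOp]

lemma angZ_radMul {h : ℝ → ℝ} (hh : ContDiffOn ℝ ∞ h (Set.Ioi 0)) (a : puncturedTest) :
    angZ (radMul h hh a) = radMul h hh (angZ a) := by
  simp only [angZ_apply, map_smul, lieOp_radMul hh inner_crossZ]

lemma angP_radMul {h : ℝ → ℝ} (hh : ContDiffOn ℝ ∞ h (Set.Ioi 0)) (a : puncturedTest) :
    angP (radMul h hh a) = radMul h hh (angP a) := by
  simp only [angP_apply, map_smul, map_add, lieOp_radMul hh inner_crossX,
    lieOp_radMul hh inner_crossY]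

lemma angM_radMul {h : ℝ → ℝ} (hh : ContDiffOn ℝ ∞ h (Set.Ioi 0)) (a : puncturedTest) :
    angM (radMul h hh a) = radMul h hh (angM a) := by
  simp only [angM_apply, map_smul, map_sub, lieOp_radMul hh inner_crossX,
    lieOp_radMul hh inner_crossY]

/-- The form `⟨f, h Λf⟩` of the spin-orbit operator `Λ = σ·L` at `f = (a, b)` with a weight. -/
lemma spinOrbitForm_radMul {p h : ℝ → ℝ} (hp : ContDiffOn ℝ ∞ p (Set.Ioi 0))
    (hh : ContDiffOn ℝ ∞ h (Set.Ioi 0)) (heq : ∀ r, 0 < r → p r * p r = h r) (s : ℂ)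
    (a b : puncturedTest) :
    spinOrbitForm puncturedIncl angZ angP angM s (radMul p hp a) (radMul p hp b) =
      inner ℂ (puncturedIncl (angZ a + angM b))
          (puncturedIncl (radMul h hh (angZ a + angM b))) +
        inner ℂ (puncturedIncl (angP a - angZ b))
          (puncturedIncl (radMul h hh (angP a - angZ b))) +
        s * (inner ℂ (puncturedIncl a) (puncturedIncl (radMul h hh (angZ a + angM b))) +
          inner ℂ (puncturedIncl b) (puncturedIncl (radMul h hh (angP a - angZ b)))) := by
  rw [spinOrbitForm]
  simp only [angZ_radMul, angP_radMul, angM_radMul, ← map_add (radMul p hp),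
    ← map_sub (radMul p hp), inner_radMul_left hp, radMul_radMul hp hp hh heq]

lemma contDiffOn_inv_id : ContDiffOn ℝ ∞ (fun r : ℝ ↦ r⁻¹) (Set.Ioi 0) :=
  contDiffOn_id.inv fun _ hr ↦ (Set.mem_Ioi.1 hr).ne'

lemma contDiffOn_inv_one_add : ContDiffOn ℝ ∞ (fun r : ℝ ↦ (1 + r)⁻¹) (Set.Ioi 0) :=
  (contDiffOn_const.add contDiffOn_id).inv fun r hr ↦ by
    have : 0 < r := hr
    positivity

lemma contDiffOn_sqrt_inv : ContDiffOn ℝ ∞ (fun r : ℝ ↦ √(r⁻¹)) (Set.Ioi 0) :=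
  contDiffOn_inv_id.sqrt fun _ hr ↦ (inv_pos.2 hr).ne'

/-- The weight `1 / (r (1 + r))`. -/
def coulombWeight (r : ℝ) : ℝ := r⁻¹ * (1 + r)⁻¹

lemma contDiffOn_coulombWeight : ContDiffOn ℝ ∞ coulombWeight (Set.Ioi 0) :=
  contDiffOn_inv_id.mul contDiffOn_inv_one_add

lemma re_inner_eulerOp_ge (a : puncturedTest) :
    ∫ x, (‖x‖⁻¹ - 1) * ‖(a : Space → ℂ) x‖ ^ 2 ≤
      (inner ℂ (puncturedIncl (eulerOp a))
        (puncturedIncl (radMul _ contDiffOn_coulombWeight (eulerOp a)))).re := by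
  have hlin : ContDiffOn ℝ ∞ (fun r : ℝ ↦ 1 + r) (Set.Ioi 0) := contDiffOn_const.add contDiffOn_id
  have hinv := contDiffOn_inv_id
  have hmu := contDiffOn_coulombWeight
  have h2 : ContDiffOn ℝ ∞ (fun r : ℝ ↦ -2 * r⁻¹) (Set.Ioi 0) := contDiffOn_const.mul hinv
  have h3 : ContDiffOn ℝ ∞ (fun r : ℝ ↦ r⁻¹ + 1) (Set.Ioi 0) := hinv.add contDiffOn_const
  have h4 : ContDiffOn ℝ ∞ (fun r : ℝ ↦ r⁻¹ - 1) (Set.Ioi 0) := hinv.sub contDiffOn_const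
  have h5 : ContDiffOn ℝ ∞ (fun r : ℝ ↦ -(r⁻¹ - 1)) (Set.Ioi 0) := h4.neg
  have hmul (r : ℝ) (hr : 0 < r) : coulombWeight r * (1 + r) = r⁻¹ := by
    rw [coulombWeight]; field_simp
  -- The completed square: Ea + (1 + r)a vanishes for the extremal profile e^{-r}/r. The cross term
  -- has weight 1/r and contributes -2∫|a|²/r by parts.
  have hpos : 0 ≤ (inner ℂ (puncturedIncl (eulerOp a + radMul _ hlin a))
      (puncturedIncl (radMul _ hmu (eulerOp a + radMul _ hlin a)))).re := by
    rw [re_inner_radMul_self]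
    refine integral_nonneg fun x ↦ mul_nonneg ?_ (sq_nonneg _)
    rw [coulombWeight]; positivity
  have hE := inner_eulerOp_radMul hinv h2 (fun r hr ↦ (hasDerivAt_inv hr.ne').congr_deriv
    (by field_simp; ring)) a a
  have hsum : inner ℂ (puncturedIncl a) (puncturedIncl (radMul _ h2 a)) +
      inner ℂ (puncturedIncl a) (puncturedIncl (radMul _ h3 a)) =
        inner ℂ (puncturedIncl a) (puncturedIncl (radMul _ h5 a)) := by
    rw [← inner_add_right, ← map_add, radMul_add h2 h3 h5 fun r _ ↦ by ring]
  have hneg : (inner ℂ (puncturedIncl a) (puncturedIncl (radMul _ h5 a))).re =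
      -∫ x, (‖x‖⁻¹ - 1) * ‖(a : Space → ℂ) x‖ ^ 2 := by
    rw [re_inner_radMul_self, ← integral_neg]
    simp only [neg_mul]
  simp only [map_add, inner_add_left, inner_add_right, inner_radMul_left hlin,
    radMul_radMul hmu hlin hinv hmul,
    radMul_radMul hlin hmu hinv (fun r hr ↦ (mul_comm _ _).trans (hmul r hr)),
    radMul_radMul hlin hinv h3 (fun r hr ↦ by field_simp)] at hpos
  have h6 := congrArg Complex.re hE
  have h7 := congrArg Complex.re hsum
  simp only [Complex.add_re] at hpos h6 h7
  linarith

/-- The Hardy-Dirac inequality for the critical Coulomb potential in terms of the radial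
derivative and the angular momentum operators, away from the origin. -/
lemma coulomb_radial_inequality (a b : puncturedTest) :
    0 ≤ (∫ x, coulombWeight ‖x‖ *
        ‖((eulerOp a - (angZ a + angM b) : puncturedTest) : Space → ℂ) x‖ ^ 2) +
      (∫ x, coulombWeight ‖x‖ *
        ‖((eulerOp b - (angP a - angZ b) : puncturedTest) : Space → ℂ) x‖ ^ 2) +
      (∫ x, (1 - ‖x‖⁻¹) * ‖(a : Space → ℂ) x‖ ^ 2) +
      ∫ x, (1 - ‖x‖⁻¹) * ‖(b : Space → ℂ) x‖ ^ 2 := by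
  have hmu := contDiffOn_coulombWeight
  have ht : ContDiffOn ℝ ∞ (fun r : ℝ ↦ (1 + r)⁻¹) (Set.Ioi 0) := contDiffOn_inv_one_add
  have hp : ContDiffOn ℝ ∞ (fun r : ℝ ↦ √(r⁻¹) * (1 + r)⁻¹) (Set.Ioi 0) :=
    contDiffOn_sqrt_inv.mul ht
  have ht2 : ContDiffOn ℝ ∞ (fun r : ℝ ↦ (1 + r)⁻¹ * (1 + r)⁻¹) (Set.Ioi 0) := ht.mul ht
  have hp2 : ContDiffOn ℝ ∞ (fun r : ℝ ↦ r⁻¹ * ((1 + r)⁻¹ * (1 + r)⁻¹)) (Set.Ioi 0) :=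
    contDiffOn_inv_id.mul ht2
  -- This is -3μ - rμ' for μ = 1/(r(1 + r)), written through the two weights into which μ splits.
  have hk : ContDiffOn ℝ ∞
      (fun r : ℝ ↦ -(2 * (r⁻¹ * ((1 + r)⁻¹ * (1 + r)⁻¹)) + (1 + r)⁻¹ * (1 + r)⁻¹)) (Set.Ioi 0) :=
    ((contDiffOn_const.mul hp2).add ht2).neg
  have hderiv (r : ℝ) (hr : 0 < r) : HasDerivAt coulombWeight ((-3 * coulombWeight r -
      -(2 * (r⁻¹ * ((1 + r)⁻¹ * (1 + r)⁻¹)) + (1 + r)⁻¹ * (1 + r)⁻¹)) / r) r := by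
    have h1 : (1 + r) ≠ 0 := by positivity
    have h2 : HasDerivAt (fun r : ℝ ↦ (1 + r)⁻¹) (-1 / (1 + r) ^ 2) r :=
      ((hasDerivAt_id r).const_add 1).inv h1
    refine ((hasDerivAt_inv hr.ne').mul h2).congr_deriv ?_
    simp only [coulombWeight]
    field_simp
    ring
  have hE := inner_eulerOp_radMul hmu hk hderiv
  set u := angZ a + angM b with hu
  set v := angP a - angZ b with hv
  have hsplit (c d : puncturedTest) :
      inner ℂ (puncturedIncl c) (puncturedIncl (radMul _ hmu d)) =
        inner ℂ (puncturedIncl c) (puncturedIncl (radMul _ hp2 d)) +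
          inner ℂ (puncturedIncl c) (puncturedIncl (radMul _ ht2 d)) := by
    rw [← inner_add_right, ← map_add, radMul_add hp2 ht2 hmu fun r hr ↦ by
      rw [coulombWeight]; field_simp]
  have hksplit (c d : puncturedTest) :
      inner ℂ (puncturedIncl c) (puncturedIncl (radMul _ hk d)) =
        -(2 * inner ℂ (puncturedIncl c) (puncturedIncl (radMul _ hp2 d)) +
          inner ℂ (puncturedIncl c) (puncturedIncl (radMul _ ht2 d))) := by
    have : radMul _ hk d = -((2 : ℂ) • radMul _ hp2 d + radMul _ ht2 d) := by
      ext x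
      change (radMul _ hk d : Space → ℂ) x =
        -(2 * (radMul _ hp2 d : Space → ℂ) x + (radMul _ ht2 d : Space → ℂ) x)
      simp only [radMul_apply]; push_cast; ring
    rw [this, map_neg, map_add, map_smul, inner_neg_right, inner_add_right, inner_smul_right]
  have hA := isAngularMomentum
  -- Λ is symmetric and commutes with E and with radial weights.
  have hcross : inner ℂ (puncturedIncl u) (puncturedIncl (radMul _ hmu (eulerOp a))) +
      inner ℂ (puncturedIncl v) (puncturedIncl (radMul _ hmu (eulerOp b))) =
        inner ℂ (puncturedIncl a) (puncturedIncl (radMul _ hmu (eulerOp u))) +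
          inner ℂ (puncturedIncl b) (puncturedIncl (radMul _ hmu (eulerOp v))) := by
    simp only [hu, hv, map_add, map_sub, inner_add_left, inner_sub_left, inner_add_right,
      inner_sub_right, hA.symm_z, hA.adjoint, hA.adjoint', eulerOp_angZ, eulerOp_angP,
      eulerOp_angM, angZ_radMul, angP_radMul, angM_radMul]
    ring
  have hQ2 := spinOrbitForm_two_nonneg (radMul _ hp a) (radMul _ hp b)
  have hQ1 := isAngularMomentum.spinOrbitForm_one_nonneg (radMul _ ht a) (radMul _ ht b)
  rw [spinOrbitForm_radMul hp hp2 (fun r hr ↦ by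
    rw [mul_mul_mul_comm, Real.mul_self_sqrt (inv_pos.2 hr).le])] at hQ2
  rw [spinOrbitForm_radMul ht ht2 (fun r _ ↦ rfl)] at hQ1
  rw [← hu, ← hv] at hQ1 hQ2
  have hflip (c : puncturedTest) : ∫ x, (1 - ‖x‖⁻¹) * ‖(c : Space → ℂ) x‖ ^ 2 =
      -∫ x, (‖x‖⁻¹ - 1) * ‖(c : Space → ℂ) x‖ ^ 2 := by
    rw [← integral_neg]
    exact integral_congr_ae (Eventually.of_forall fun x ↦ by ring)
  have e1 := re_inner_eulerOp_ge a
  have e2 := re_inner_eulerOp_ge b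
  -- μ = 1/(r(1 + r)²) + 1/(1 + r)² multiplies |Λf|², and the cross term contributes ⟨f, Λf⟩ with
  -- twice the first weight plus once the second: hence Λ² + 2Λ and Λ² + Λ.
  have e3 : inner ℂ (puncturedIncl (eulerOp a - u)) (puncturedIncl (radMul _ hmu (eulerOp a - u))) +
      inner ℂ (puncturedIncl (eulerOp b - v)) (puncturedIncl (radMul _ hmu (eulerOp b - v))) =
      inner ℂ (puncturedIncl (eulerOp a)) (puncturedIncl (radMul _ hmu (eulerOp a))) +
      inner ℂ (puncturedIncl (eulerOp b)) (puncturedIncl (radMul _ hmu (eulerOp b))) +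
      (inner ℂ (puncturedIncl u) (puncturedIncl (radMul _ hp2 u)) +
        inner ℂ (puncturedIncl v) (puncturedIncl (radMul _ hp2 v)) +
        2 * (inner ℂ (puncturedIncl a) (puncturedIncl (radMul _ hp2 u)) +
          inner ℂ (puncturedIncl b) (puncturedIncl (radMul _ hp2 v)))) +
      (inner ℂ (puncturedIncl u) (puncturedIncl (radMul _ ht2 u)) +
        inner ℂ (puncturedIncl v) (puncturedIncl (radMul _ ht2 v)) +
        1 * (inner ℂ (puncturedIncl a) (puncturedIncl (radMul _ ht2 u)) +
          inner ℂ (puncturedIncl b) (puncturedIncl (radMul _ ht2 v)))) := by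
    simp only [map_sub, inner_sub_left, inner_sub_right]
    linear_combination hsplit u u + hsplit v v - hcross - hE a u - hE b v - hksplit a u -
      hksplit b v
  have e4 := congrArg Complex.re e3
  rw [Complex.add_re] at e4
  rw [← re_inner_radMul_self hmu, ← re_inner_radMul_self hmu, hflip, hflip, e4,
    Complex.add_re, Complex.add_re, Complex.add_re]
  linarith

end RadialEstimate

/-! ### Local integrability of 1/|x|² and the factorisation of σ·∇. -/

section Coulomb

lemma locallyL2_coulomb : LocallyL2 fun x ↦ -1 / ‖x‖ := by
  have hmeas : Measurable fun x : Space ↦ -1 / ‖x‖ := measurable_const.div measurable_norm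
  have h : LocallyIntegrable (fun x : Space ↦ (-1 / ‖x‖) ^ 2) volume := by
    refine locallyIntegrable_of_norm_le_rpow (C := 1) (α := 2) ?_ ?_ ?_ ?_
    · simp
    · simp; norm_num
    · refine Eventually.of_forall fun x ↦ ?_
      rw [Real.rpow_neg (norm_nonneg _)]
      norm_num [div_pow]
    · exact (hmeas.pow_const 2).aestronglyMeasurable
  intro K hK
  rw [memLp_two_iff_integrable_sq hmeas.aestronglyMeasurable]
  exact h.integrableOn_isCompact hK

lemma norm_sq_spinor (v : Spinor) : ‖v‖ ^ 2 = ‖v 0‖ ^ 2 + ‖v 1‖ ^ 2 := by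
  rw [EuclideanSpace.norm_sq_eq, Fin.sum_univ_two]

/-- `|σ·x v|² = |x|² |v|²`. -/
lemma norm_sq_sigma_dot (p q r : ℝ) (s t : ℂ) :
    ‖r * s + (p - Complex.I * q) * t‖ ^ 2 + ‖(p + Complex.I * q) * s - r * t‖ ^ 2 =
      (p ^ 2 + q ^ 2 + r ^ 2) * (‖s‖ ^ 2 + ‖t‖ ^ 2) := by
  simp only [Complex.sq_norm, Complex.normSq_apply, Complex.add_re, Complex.add_im, Complex.sub_re,
    Complex.sub_im, Complex.mul_re, Complex.mul_im, Complex.ofReal_re, Complex.ofReal_im,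
    Complex.I_re, Complex.I_im]
  ring

lemma component_mem {f : Space → Spinor} (hf : IsTest f) (h0 : f =ᶠ[𝓝 0] 0) (i : Fin 2) :
    (fun x ↦ f x i) ∈ puncturedTest := by
  refine ⟨((EuclideanSpace.proj i : Spinor →L[ℂ] ℂ).restrictScalars ℝ).contDiff.comp hf.1, ?_, ?_⟩
  · exact hf.2.comp_left (g := fun v : Spinor ↦ v i) rfl
  · filter_upwards [h0] with x hx
    rw [hx]; rfl

lemma fderiv_component {f : Space → Spinor} (hf : IsTest f) (i : Fin 2) (x v : Space) :
    fderiv ℝ (fun y ↦ f y i) x v = fderiv ℝ f x v i := by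
  have h := (((EuclideanSpace.proj i : Spinor →L[ℂ] ℂ).restrictScalars ℝ).hasFDerivAt.comp x
    hf.differentiable.differentiableAt.hasFDerivAt).fderiv
  exact congrArg (fun L : Space →L[ℝ] ℂ ↦ L v) h

/-- Because (σ·x)(σ·∇) = x·∇ - σ·L, and |σ·x v| = |x||v| pointwise. -/
lemma norm_sq_mul_norm_sigmaGrad_sq {f : Space → Spinor} (hf : IsTest f) (a b : puncturedTest)
    (ha : (a : Space → ℂ) = fun x ↦ f x 0) (hb : (b : Space → ℂ) = fun x ↦ f x 1) (x : Space) :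
    ‖((eulerOp a - (angZ a + angM b) : puncturedTest) : Space → ℂ) x‖ ^ 2 +
      ‖((eulerOp b - (angP a - angZ b) : puncturedTest) : Space → ℂ) x‖ ^ 2 =
        ‖x‖ ^ 2 * ‖sigmaGrad f x‖ ^ 2 := by
  set D : Fin 3 → Spinor := fun k ↦ fderiv ℝ f x (EuclideanSpace.single k 1)
  have hl (c : puncturedTest) (i : Fin 2) (hc : (c : Space → ℂ) = fun x ↦ f x i)
      (B : Space →L[ℝ] Space) : (lieOp B c : Space → ℂ) x =
        (B x 0 : ℂ) * D 0 i + (B x 1 : ℂ) * D 1 i + (B x 2 : ℂ) * D 2 i := by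
    rw [lieOp_apply, hc, fderiv_component hf, fderiv_apply_eq_sum, Fin.sum_univ_three]
    simp [D]
  have e0 : ((eulerOp a - (angZ a + angM b) : puncturedTest) : Space → ℂ) x =
      (lieOp (ContinuousLinearMap.id ℝ Space) a : Space → ℂ) x -
        (-Complex.I * (lieOp crossZ a : Space → ℂ) x +
          (-Complex.I * (lieOp crossX b : Space → ℂ) x - (lieOp crossY b : Space → ℂ) x)) := rfl
  have e1 : ((eulerOp b - (angP a - angZ b) : puncturedTest) : Space → ℂ) x =
      (lieOp (ContinuousLinearMap.id ℝ Space) b : Space → ℂ) x -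
        (-Complex.I * (lieOp crossX a : Space → ℂ) x + (lieOp crossY a : Space → ℂ) x -
          -Complex.I * (lieOp crossZ b : Space → ℂ) x) := rfl
  have s0 : sigmaGrad f x 0 = D 1 1 * (-Complex.I) + D 0 1 + D 2 0 := by
    simp [sigmaGrad, Fin.sum_univ_three, pauli, Matrix.mulVec, dotProduct, D]
    ring
  have s1 : sigmaGrad f x 1 = D 1 0 * Complex.I + D 0 0 - D 2 1 := by
    simp [sigmaGrad, Fin.sum_univ_three, pauli, Matrix.mulVec, dotProduct, D]
    ring
  rw [norm_sq_spinor (sigmaGrad f x), EuclideanSpace.norm_sq_eq, Fin.sum_univ_three]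
  simp only [Real.norm_eq_abs, sq_abs]
  rw [← norm_sq_sigma_dot, s0, s1, e0, e1]
  simp only [hl a 0 ha, hl b 1 hb, crossX_apply, crossY_apply, crossZ_apply,
    ContinuousLinearMap.id_apply]
  congr 3
  · simp
    linear_combination ((x 1 : ℂ) * D 1 0) * Complex.I_sq
  · simp
    linear_combination ((x 1 : ℂ) * D 1 1) * Complex.I_sq

end Coulomb

/-! ### Assumption (A) for the critical Coulomb potential. -/

section CoulombAssumption

lemma integrable_radial_mul_sq {h : ℝ → ℝ} (hh : ContDiffOn ℝ ∞ h (Set.Ioi 0)) (a : puncturedTest) :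
    Integrable fun x ↦ h ‖x‖ * ‖(a : Space → ℂ) x‖ ^ 2 := by
  refine (integrable_inner_puncturedTest a (radMul h hh a)).re.congr
    (Eventually.of_forall fun x ↦ ?_)
  change RCLike.re (inner ℂ ((a : Space → ℂ) x) (((h ‖x‖ : ℝ) : ℂ) * (a : Space → ℂ) x)) = _
  rw [← smul_eq_mul, inner_smul_right, RCLike.re_to_complex, Complex.re_ofReal_mul]
  congr 1
  exact (norm_sq_eq_re_inner (𝕜 := ℂ) ((a : Space → ℂ) x)).symm

/-- The Hardy-Dirac inequality for the critical Coulomb potential and test spinors that vanish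
near the origin. -/
lemma hardyDirac_coulomb_of_eventuallyEq_zero {f : Space → Spinor} (hf : IsTest f)
    (h0 : f =ᶠ[𝓝 0] 0) :
    0 ≤ ∫ x, (‖sigmaGrad f x‖ ^ 2 / (1 + 0 - -1 / ‖x‖) + (1 - 0 + -1 / ‖x‖) * ‖f x‖ ^ 2) := by
  set a : puncturedTest := ⟨_, component_mem hf h0 0⟩
  set b : puncturedTest := ⟨_, component_mem hf h0 1⟩
  have hw : ContDiffOn ℝ ∞ (fun r : ℝ ↦ 1 - r⁻¹) (Set.Ioi 0) :=
    contDiffOn_const.sub contDiffOn_inv_id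
  have i1 := integrable_radial_mul_sq contDiffOn_coulombWeight
    (eulerOp a - (angZ a + angM b) : puncturedTest)
  have i2 := integrable_radial_mul_sq contDiffOn_coulombWeight
    (eulerOp b - (angP a - angZ b) : puncturedTest)
  have i3 := integrable_radial_mul_sq hw a
  have i4 := integrable_radial_mul_sq hw b
  refine (coulomb_radial_inequality a b).trans_eq ?_
  rw [← integral_add' i1 i2, ← integral_add' (i1.add i2) i3,
    ← integral_add' ((i1.add i2).add i3) i4]
  refine integral_congr_ae (Eventually.of_forall fun x ↦ ?_)
  change coulombWeight ‖x‖ * _ + coulombWeight ‖x‖ * _ + _ + _ = _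
  -- For r > 0, r² times 1/(r(1 + r)) is 1/(1 + 1/r). At the origin both sides vanish because f is
  -- zero nearby.
  rw [← mul_add, norm_sq_mul_norm_sigmaGrad_sq hf a b rfl rfl, add_assoc, ← mul_add]
  refine congrArg₂ (· + ·) ?_ ?_
  · rcases eq_or_ne x 0 with rfl | hx
    · have : sigmaGrad f 0 = 0 := by simp [sigmaGrad, h0.fderiv_eq]
      simp [this]
    · have : 0 < ‖x‖ := norm_pos_iff.2 hx
      have h1 : 1 + ‖x‖ ≠ 0 := by positivity
      have h2 : (1 : ℝ) + 0 - -1 / ‖x‖ = (1 + ‖x‖) / ‖x‖ := by field_simp; ring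
      rw [coulombWeight, h2]
      field_simp
  · change (1 - ‖x‖⁻¹) * (‖f x 0‖ ^ 2 + ‖f x 1‖ ^ 2) = _
    rw [← norm_sq_spinor]
    ring

lemma sigmaGrad_smul {χ : Space → ℝ} (hχ : Differentiable ℝ χ) {f : Space → Spinor}
    (hf : Differentiable ℝ f) (x : Space) :
    sigmaGrad (fun y ↦ χ y • f y) x = χ x • sigmaGrad f x +
      ∑ k, fderiv ℝ χ x (EuclideanSpace.single k 1) • pauliCLM k (f x) := by
  simp only [sigmaGrad_eq, Finset.sum_apply, fderiv_fun_smul (hχ x) (hf x), Finset.smul_sum,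
    ← Finset.sum_add_distrib]
  simp

lemma norm_sigmaGrad_smul_le {χ : Space → ℝ} (hχ : Differentiable ℝ χ) {f : Space → Spinor}
    (hf : Differentiable ℝ f) (x : Space) :
    ‖sigmaGrad (fun y ↦ χ y • f y) x‖ ≤ |χ x| * ‖sigmaGrad f x‖ +
      ‖fderiv ℝ χ x‖ * (∑ k, ‖pauliCLM k‖) * ‖f x‖ := by
  rw [sigmaGrad_smul hχ hf]
  refine (norm_add_le _ _).trans (add_le_add (norm_smul _ _).le ?_)
  refine (norm_sum_le _ _).trans ?_
  rw [Finset.mul_sum, Finset.sum_mul]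
  refine Finset.sum_le_sum fun k _ ↦ ?_
  rw [norm_smul, mul_assoc]
  refine mul_le_mul ?_ ((pauliCLM k).le_opNorm _) (norm_nonneg _) (norm_nonneg _)
  simpa using (fderiv ℝ χ x).le_opNorm (EuclideanSpace.single k 1)

/-- A bump function at the origin. -/
def originBump : ContDiffBump (0 : Space) := ⟨1, 2, one_pos, one_lt_two⟩

/-- A smooth function that vanishes near the origin and equals `1` for `|x| > 2 / n`. -/
def originCutoff (n : ℕ) (x : Space) : ℝ := 1 - originBump ((n : ℝ) • x)

lemma contDiff_originCutoff (n : ℕ) : ContDiff ℝ ∞ (originCutoff n) :=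
  contDiff_const.sub (originBump.contDiff.comp (contDiff_const_smul _))

lemma abs_originCutoff_le (n : ℕ) (x : Space) : |originCutoff n x| ≤ 1 := by
  have h1 := originBump.nonneg (x := (n : ℝ) • x)
  have h2 := originBump.le_one (x := (n : ℝ) • x)
  rw [originCutoff, abs_le]
  constructor <;> linarith

lemma originCutoff_eventuallyEq_zero (n : ℕ) : originCutoff n =ᶠ[𝓝 0] 0 := by
  have h : Tendsto (fun x : Space ↦ (n : ℝ) • x) (𝓝 0) (𝓝 0) :=
    ((continuous_const_smul (n : ℝ)).tendsto' 0 0 (smul_zero _))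
  filter_upwards [h.eventually originBump.eventuallyEq_one] with x hx
  simp [originCutoff, hx]

lemma originCutoff_eventuallyEq_one {x : Space} {n : ℕ} (hx : 2 < n * ‖x‖) :
    originCutoff n =ᶠ[𝓝 x] 1 := by
  have h : ∀ᶠ y in 𝓝 x, 2 < n * ‖y‖ :=
    (continuous_const.mul continuous_norm).continuousAt.eventually (lt_mem_nhds hx)
  filter_upwards [h] with y hy
  have : originBump ((n : ℝ) • y) = 0 := originBump.zero_of_le_dist (by
    rw [dist_zero_right, norm_smul, Real.norm_natCast]; exact hy.le)
  simp [originCutoff, this]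

/-- |∇χ||x| is invariant under dilations, so one bound serves all n. -/
lemma exists_norm_fderiv_originCutoff_le :
    ∃ C, ∀ n x, ‖fderiv ℝ (originCutoff n) x‖ * ‖x‖ ≤ C := by
  have hc : Continuous fun y ↦ ‖fderiv ℝ originBump y‖ * ‖y‖ :=
    (originBump.contDiff.continuous_fderiv (n := 1) (by simp)).norm.mul continuous_norm
  obtain ⟨C, hC⟩ := hc.bounded_above_of_compact_support
    ((originBump.hasCompactSupport.fderiv ℝ).norm.mul_right)
  refine ⟨C, fun n x ↦ ?_⟩
  have hd : fderiv ℝ (originCutoff n) x = -((n : ℝ) • fderiv ℝ originBump ((n : ℝ) • x)) := by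
    change fderiv ℝ (fun y ↦ 1 - originBump ((n : ℝ) • y)) x = _
    rw [fderiv_const_sub, fderiv_comp_smul]
  refine (le_of_eq ?_).trans ((le_abs_self _).trans (hC ((n : ℝ) • x)))
  rw [hd, norm_neg, norm_smul, norm_smul]
  ring

/-- A majorant independent of the cutoff. The dangerous term |∇χ|²|f|² is at most C²|f|²/r², and the
weight 1/(1 + 1/r) ≤ r reduces it to |f|²/r, which is integrable in dimension three. -/
lemma norm_coulomb_integrand_smul_le {χ : Space → ℝ} (hχ : Differentiable ℝ χ)
    (h1 : ∀ x, |χ x| ≤ 1) {C : ℝ} (hC : ∀ x, ‖fderiv ℝ χ x‖ * ‖x‖ ≤ C)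
    {f : Space → Spinor} (hf : Differentiable ℝ f) {x : Space} (hr : 0 < ‖x‖) :
    ‖‖sigmaGrad (fun y ↦ χ y • f y) x‖ ^ 2 / (1 + 0 - -1 / ‖x‖) +
      (1 - 0 + -1 / ‖x‖) * ‖χ x • f x‖ ^ 2‖ ≤ 2 * ‖sigmaGrad f x‖ ^ 2 +
        (2 * (C * ∑ k, ‖pauliCLM k‖) ^ 2 + 1) * (‖x‖⁻¹ * ‖f x‖ ^ 2) + ‖f x‖ ^ 2 := by
  have hP0 : 0 ≤ ∑ k, ‖pauliCLM k‖ := Finset.sum_nonneg fun _ _ ↦ norm_nonneg _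
  have hN := norm_sigmaGrad_smul_le hχ hf x
  have hden : (1 : ℝ) + 0 - -1 / ‖x‖ = 1 + ‖x‖⁻¹ := by ring
  generalize ∑ k, ‖pauliCLM k‖ = P at hP0 hN ⊢
  have hgn : ‖χ x • f x‖ ≤ ‖f x‖ := by
    rw [norm_smul]
    exact mul_le_of_le_one_left (norm_nonneg _) (h1 x)
  have hσ : ‖sigmaGrad (fun y ↦ χ y • f y) x‖ ≤ ‖sigmaGrad f x‖ + C * P * (‖x‖⁻¹ * ‖f x‖) := by
    refine hN.trans (add_le_add (mul_le_of_le_one_left (norm_nonneg _) (h1 x)) ?_)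
    have : ‖fderiv ℝ χ x‖ ≤ C * ‖x‖⁻¹ := by
      rw [← div_eq_mul_inv, le_div_iff₀ hr]
      exact hC x
    calc _ ≤ C * ‖x‖⁻¹ * P * ‖f x‖ := by gcongr
      _ = _ := by ring
  have hσ2 : ‖sigmaGrad (fun y ↦ χ y • f y) x‖ ^ 2 ≤
      2 * ‖sigmaGrad f x‖ ^ 2 + 2 * (C * P) ^ 2 * (‖x‖⁻¹ ^ 2 * ‖f x‖ ^ 2) := by
    calc _ ≤ (‖sigmaGrad f x‖ + C * P * (‖x‖⁻¹ * ‖f x‖)) ^ 2 := by gcongr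
      _ ≤ 2 * (‖sigmaGrad f x‖ ^ 2 + (C * P * (‖x‖⁻¹ * ‖f x‖)) ^ 2) := add_sq_le
      _ = _ := by ring
  have hfst : ‖sigmaGrad (fun y ↦ χ y • f y) x‖ ^ 2 / (1 + 0 - -1 / ‖x‖) ≤
      2 * ‖sigmaGrad f x‖ ^ 2 + 2 * (C * P) ^ 2 * (‖x‖⁻¹ * ‖f x‖ ^ 2) := by
    have hpos : 0 < ‖x‖⁻¹ := inv_pos.2 hr
    rw [hden, div_le_iff₀ (by positivity)]
    refine hσ2.trans ?_
    have e1 : 0 ≤ ‖sigmaGrad f x‖ ^ 2 * ‖x‖⁻¹ := by positivity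
    have e2 : 0 ≤ (C * P) ^ 2 * (‖x‖⁻¹ * ‖f x‖ ^ 2) := by positivity
    linear_combination 2 * e1 + 2 * e2
  have hsnd : |(1 - 0 + -1 / ‖x‖) * ‖χ x • f x‖ ^ 2| ≤ (1 + ‖x‖⁻¹) * ‖f x‖ ^ 2 := by
    rw [abs_mul, abs_of_nonneg (sq_nonneg ‖χ x • f x‖)]
    have : |1 - 0 + -1 / ‖x‖| ≤ 1 + ‖x‖⁻¹ := by
      have hpos : 0 < ‖x‖⁻¹ := inv_pos.2 hr
      rw [sub_zero, neg_div, one_div, abs_le]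
      constructor <;> linarith
    gcongr
  refine (norm_add_le _ _).trans ?_
  rw [Real.norm_of_nonneg (by rw [hden]; positivity), Real.norm_eq_abs]
  linarith

lemma IsTest.smul {χ : Space → ℝ} (hχ : ContDiff ℝ ∞ χ) {f : Space → Spinor} (hf : IsTest f) :
    IsTest fun x ↦ χ x • f x := by
  have h : ContDiff ℝ ∞ fun x ↦ χ x • f x := hχ.smul hf.1
  have hc : HasCompactSupport fun x ↦ χ x • f x := by
    refine hf.2.mono fun x hx h0 ↦ hx ?_
    change χ x • f x = 0
    rw [h0, smul_zero]
  exact ⟨h, hc⟩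

/-- The Hardy-Dirac inequality for the critical Coulomb potential. -/
lemma hardyDirac_coulomb {f : Space → Spinor} (hf : IsTest f) :
    0 ≤ ∫ x, (‖sigmaGrad f x‖ ^ 2 / (1 + 0 - -1 / ‖x‖) + (1 - 0 + -1 / ‖x‖) * ‖f x‖ ^ 2) := by
  obtain ⟨C, hC⟩ := exists_norm_fderiv_originCutoff_le
  have hne : ∀ᵐ x : Space, x ≠ 0 := by simp [ae_iff]
  obtain ⟨g, hgdef⟩ : ∃ g : ℕ → Space → Spinor, ∀ n, g n = fun x ↦ originCutoff n x • f x :=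
    ⟨_, fun _ ↦ rfl⟩
  have hg (n : ℕ) : IsTest (g n) := hgdef n ▸ hf.smul (contDiff_originCutoff n)
  have hg0 (n : ℕ) : g n =ᶠ[𝓝 0] 0 := by
    filter_upwards [originCutoff_eventuallyEq_zero n] with x hx
    simp [hgdef, hx]
  have hiσ : Integrable fun x ↦ ‖sigmaGrad f x‖ ^ 2 := by
    simpa using (LocallyL2.const 1).integrable_wNormSq ⟨_, hf.sigmaGrad⟩
  have hi : Integrable fun x ↦ ‖f x‖ ^ 2 := by
    simpa using (LocallyL2.const 1).integrable_wNormSq ⟨_, hf⟩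
  have hic : Integrable fun x ↦ ‖x‖⁻¹ * ‖f x‖ ^ 2 := by
    simpa [neg_div] using (locallyL2_coulomb.integrable_wNormSq ⟨_, hf⟩).neg
  have hm (n : ℕ) : AEStronglyMeasurable (fun x ↦ ‖sigmaGrad (g n) x‖ ^ 2 / (1 + 0 - -1 / ‖x‖) +
      (1 - 0 + -1 / ‖x‖) * ‖g n x‖ ^ 2) volume := by
    have h1 := (hg n).1.continuous.measurable
    have h2 := (hg n).sigmaGrad.1.continuous.measurable
    exact Measurable.aestronglyMeasurable (by fun_prop)
  -- Dominated convergence as the cutoff shrinks: near any x ≠ 0, the cut-off spinor eventually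
  -- equals f.
  refine ge_of_tendsto' (x := atTop) ?_ fun n ↦
    hardyDirac_coulomb_of_eventuallyEq_zero (hg n) (hg0 n)
  refine tendsto_integral_of_dominated_convergence
    (fun x ↦ 2 * ‖sigmaGrad f x‖ ^ 2 + (2 * (C * ∑ k, ‖pauliCLM k‖) ^ 2 + 1) *
      (‖x‖⁻¹ * ‖f x‖ ^ 2) + ‖f x‖ ^ 2)
    hm (((hiσ.const_mul 2).add (hic.const_mul _)).add hi) (fun n ↦ ?_) ?_
  · filter_upwards [hne] with x hx
    rw [hgdef]
    exact norm_coulomb_integrand_smul_le ((contDiff_originCutoff n).differentiable (by simp))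
      (abs_originCutoff_le n) (hC n) hf.differentiable (norm_pos_iff.2 hx)
  · filter_upwards [hne] with x hx
    refine tendsto_const_nhds.congr' ?_
    have hlim : Tendsto (fun n : ℕ ↦ (n : ℝ) * ‖x‖) atTop atTop :=
      tendsto_natCast_atTop_atTop.atTop_mul_const (norm_pos_iff.2 hx)
    filter_upwards [hlim.eventually_gt_atTop 2] with n hn
    have he : g n =ᶠ[𝓝 x] f := by
      filter_upwards [originCutoff_eventuallyEq_one hn] with y hy
      simp [hgdef, hy]
    have hs : sigmaGrad (g n) x = sigmaGrad f x := by simp only [sigmaGrad, he.fderiv_eq]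
    rw [hs, he.eq_of_nhds]

lemma assumptionA_coulomb : AssumptionA (fun x ↦ -1 / ‖x‖) 0 := by
  -- The bound includes the origin, where the default value of the quotient is 0.
  have h (x : Space) : -1 / ‖x‖ ≤ 0 := div_nonpos_of_nonpos_of_nonneg (by simp) (norm_nonneg _)
  refine ⟨by simp, by simp, ⟨0, Set.forall_mem_range.2 h⟩, ?_, fun f ↦ hardyDirac_coulomb⟩
  exact (ciSup_le h).trans_lt (by simp)

end CoulombAssumption

end HardyDirac

end

theorem theorem2 :
    -- the main result, for every potential satisfying Assumption (A)
    (∀ (V : Space → ℝ) (c : ℝ), LocallyL2 V → AssumptionA V c →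
      -- the space `ℋ_{+1}` does not depend on `γ`
      (∀ γ ∈ Set.Ioo (⨆ x, V x) (1 + c), ∀ γ' ∈ Set.Ioo (⨆ x, V x) (1 + c),
        formDomain V γ = formDomain V γ') ∧
      ∀ γ ∈ Set.Ioo (⨆ x, V x) (1 + c),
        ∃ H : L2Pair →ₗ.[ℂ] L2Pair,
          IsDiracOperator V γ H ∧
          IsSelfAdjoint H ∧
          ExtendsDirac V H ∧
          ∀ T : L2Pair →ₗ.[ℂ] L2Pair, IsSelfAdjoint T → ExtendsDirac V T →
            (∀ u ∈ T.domain, u.fst ∈ formDomain V γ) → T = H) ∧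
    -- the critical Coulomb potential is covered
    (LocallyL2 (fun x => -1 / ‖x‖) ∧ AssumptionA (fun x => -1 / ‖x‖) 0) := by
  refine ⟨fun V c hV hA ↦ ⟨fun γ hγ γ' hγ' ↦ ?_, fun γ hγ ↦ exists_diracOperator hV hA hγ⟩,
    locallyL2_coulomb, assumptionA_coulomb⟩
  exact (formDomain_subset hV hA hγ' hγ).antisymm (formDomain_subset hV hA hγ hγ')
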